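/- **Model.** Let $\lambda_{\rm BS},\lambda_{\rm RIS},\beta,P_0,T>0$, $\alpha>2$, $0\le R_{\rm in}<R_{\rm out}$, integers $0\le M_o\le M$, $\vartheta\in[0,2\pi]$ and Rician factors $\kappa_1,\kappa_2\ge 0$. Put $g(d)=\beta(d+1)^{-\alpha}$ and $G(\mathbf x,\mathbf y)=g(\|\mathbf y\|)\,g(\|\mathbf x-\mathbf y\|)$ for $\mathbf x,\mathbf y\in\mathbb R^2$. *Fading.* Let $\zeta=\rho_1\rho_2$ with $\rho_1,\rho_2$ independent, $\rho_k\sim\sqrt{\kappa_k/(\kappa_k+1)}+\sqrt{1/(\kappa_k+1)}\;\mathcal{CN}(0,1)$, and put $\mu=M_o\mathbb E|\zeta|$, $\sigma_\Re^2=\frac{M+M_o}{2}\mathbb V|\zeta|$, $\sigma_\Im^2=\frac{M-M_o}{2}\mathbb V|\zeta|$. Let $\gamma_{S_R}=X^2+Y^2$ with $X\sim\mathcal N(\mu,\sigma_\Re^2)$ and $Y\sim\mathcal N(0,\sigma_\Im^2)$ independent. Let $\gamma_{I_R}$ be distributed as $\gamma_{S_R}$ with probability $\vartheta/2\pi$,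 and as an exponential variable with mean $M-M_o$ (the constant $0$ if $M=M_o$) with probability $1-\vartheta/2\pi$. For a nonnegative random variable $X$ write $\mathcal L_X(s)=\mathbb E[e^{-sX}]$, $\Re s\ge 0$. *Network.* The base stations (BSs) $\mathbf x_0,\mathbf x_1,\dots$ form a homogeneous Poisson point process of density $\lambda_{\rm BS}$ on $\mathbb R^2$. The BS at $\mathbf x_i$ carries a cluster of RISs $\mathbf y_{i,1},\dots,\mathbf y_{i,K_i}$, where $K_i$ is Poisson of mean $\lambda_{\rm RIS}\pi(R_{\rm out}^2-R_{\rm in}^2)$ and the displacements $\mathbf y_{i,j}-\mathbf x_i$ are uniform on the annulus $\{R_{\rm in}\le\|\mathbf u\|\le R_{\rm out}\}$; the direct fading powers $\gamma_{I_{D_i}}$ are ${\rm Exp}(1)$ and the reflected fading powers $\gamma_{I_{R_{i,j}}}$ are distributed as $\gamma_{I_R}$. The process of BSs and all the variables $K_i$, $\mathbf y_{i,j}-\mathbf x_i$, $\gamma_{I_{D_i}}$, $\gamma_{I_{R_{i,j}}}$ are independent. The user at the origin is served by its nearest BS $\mathbf x_o$. The interference power from cell $i$ and the total interference power are $$Q_{c_i}=\gamma_{I_{D_i}}P_0\,g(\|\mathbf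 x_i\|)+\sum_{j=1}^{K_i}\gamma_{I_{R_{i,j}}}P_0\,G(\mathbf x_i,\mathbf y_{i,j}),\qquad Q_I=\sum_{i\neq o}Q_{c_i}.$$ Let $Q_c(x)$ denote the interference power from one such cell whose BS is at a fixed point at distance $x\ge0$ from the origin. **Claim.** The series $Q_I$ converges almost surely. Let $s\in\mathbb C$ with $\Re s\ge0$. For every $r\ge 0$ the integral $\int_r^\infty x\,(1-\mathcal L_{TQ_c(x)}(s))\,dx$ converges absolutely, and almost surely, with $r=\|\mathbf x_o\|$, $$\mathbb E\big[e^{-sTQ_I}\,\big|\,\|\mathbf x_o\|\big]=\exp\Big(-2\pi\lambda_{\rm BS}\int_r^\infty x\,\big(1-\mathcal L_{TQ_c(x)}(s)\big)\,dx\Big).$$ For every $x\ge0$, and whatever the direction of the BS, $$\begin{aligned}\mathcal L_{TQ_c(x)}(s)=\frac{1}{1+sP_0Tg(x)}&\exp\Big(-\frac{\vartheta}{2\pi}\lambda_{\rm RIS}\int_0^{2\pi}\!\!\int_{R_{\rm in}}^{R_{\rm out}}y\,\big(1-\mathcal L_{\gamma_{S_R}}(sP_0T\mathcal G(x,y,\psi))\big)\,dy\,d\psi\Big)\\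 \times&\exp\Big(-\Big(1-\frac{\vartheta}{2\pi}\Big)\lambda_{\rm RIS}\int_0^{2\pi}\!\!\int_{R_{\rm in}}^{R_{\rm out}}y\,\Big(1-\frac{1}{1+s(M-M_o)P_0T\mathcal G(x,y,\psi)}\Big)\,dy\,d\psi\Big),\end{aligned}$$ where $\mathcal G(x,y,\psi)=g(y)\,g\big(\sqrt{x^2+y^2-2xy\cos\psi}\big)$ and, with the principal square root, $$\mathcal L_{\gamma_{S_R}}(s)=\frac{\exp\big(-\frac{\mu^2s}{1+2s\sigma_\Re^2}\big)}{\sqrt{(1+2s\sigma_\Re^2)(1+2s\sigma_\Im^2)}}.$$ -/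

import Mathlib

open MeasureTheory ProbabilityTheory Set
open scoped ENNReal NNReal

noncomputable section

/-- The plane `ℝ²` with its Euclidean norm. The typical user sits at the origin. -/
abbrev Plane : Type := EuclideanSpace ℝ (Fin 2)

/-- Deterministic parameters of the RIS-assisted cellular network. -/
structure NetworkParams where
  /-- density of base stations (BSs) -/
  densBS : ℝ
  /-- density of RISs inside a cluster -/
  densRIS : ℝ
  /-- inner and outer radius of a cluster -/
  Rin : ℝ
  Rout : ℝ
  /-- path loss `g d = β (d + 1) ^ (-α)` -/
  α : ℝ
  β : ℝ
  /-- transmit power and SINR threshold -/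
  P₀ : ℝ
  T : ℝ
  /-- number of elements per RIS, and number of elements in the batch forming a beam -/
  M : ℕ
  Mo : ℕ
  /-- beamwidth in radians -/
  beam : ℝ
  /-- Rician factors of the BS-RIS link and of the RIS-user link -/
  κ₁ : ℝ
  κ₂ : ℝ
  densBS_pos : 0 < densBS
  densRIS_pos : 0 < densRIS
  Rin_nonneg : 0 ≤ Rin
  Rin_lt_Rout : Rin < Rout
  two_lt_α : 2 < α
  β_pos : 0 < β
  P₀_pos : 0 < P₀
  T_pos : 0 < T
  Mo_le_M : Mo ≤ M
  beam_nonneg : 0 ≤ beam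
  beam_le : beam ≤ 2 * Real.pi
  κ₁_nonneg : 0 ≤ κ₁
  κ₂_nonneg : 0 ≤ κ₂

/-! ### Fading laws -/

/-- The circular complex Gaussian law `CN(0, 1)`. -/
def complexGaussian : Measure ℂ :=
  ((gaussianReal 0 (1 / 2)).prod (gaussianReal 0 (1 / 2))).map
    (fun q : ℝ × ℝ => (q.1 : ℂ) + (q.2 : ℂ) * Complex.I)

/-- The Rician law with factor `κ`: the law of `√(κ/(κ+1)) + √(1/(κ+1)) Z`, with `Z ~ CN(0, 1)`.
For `κ = 0` this is Rayleigh fading. -/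
def ricianLaw (κ : ℝ) : Measure ℂ :=
  complexGaussian.map
    (fun z : ℂ => (Real.sqrt (κ / (κ + 1)) : ℂ) + (Real.sqrt (1 / (κ + 1)) : ℂ) * z)

namespace NetworkParams

variable (p : NetworkParams)

/-- Law of the fading `ζ = ρ_{R₁} ρ_{R₂}` of one RIS element, product of two independent
Rician fadings. -/
def zetaLaw : Measure ℂ :=
  ((ricianLaw p.κ₁).prod (ricianLaw p.κ₂)).map (fun q : ℂ × ℂ => q.1 * q.2)

/-- `E[|ζ|]` -/
def zetaMean : ℝ := ∫ z, ‖z‖ ∂p.zetaLaw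

/-- `V[|ζ|]` -/
def zetaVar : ℝ := Var[fun z : ℂ => ‖z‖; p.zetaLaw]

/-- `μ = M_o E[|ζ|]` -/
def muRe : ℝ := p.Mo * p.zetaMean

/-- `σ_ℜ² = (M + M_o) / 2 * V[|ζ|]` -/
def varRe : ℝ := ((p.M : ℝ) + p.Mo) / 2 * p.zetaVar

/-- `σ_ℑ² = (M - M_o) / 2 * V[|ζ|]` -/
def varIm : ℝ := ((p.M : ℝ) - p.Mo) / 2 * p.zetaVar

/-- Law of the beamformed fading power `γ_{S_R} = |η|²`, where `ℜ η ~ N(μ, σ_ℜ²)` and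
`ℑ η ~ N(0, σ_ℑ²)` are independent. -/
def beamPowerLaw : Measure ℝ :=
  ((gaussianReal p.muRe p.varRe.toNNReal).prod (gaussianReal 0 p.varIm.toNNReal)).map
    (fun q : ℝ × ℝ => q.1 ^ 2 + q.2 ^ 2)

/-- Law of the scattered fading power: exponential with scale (mean) `M - M_o`. -/
def scatterPowerLaw : Measure ℝ :=
  (expMeasure 1).map (fun t : ℝ => ((p.M : ℝ) - p.Mo) * t)

/-- Law of the fading power `γ_{I_R}` of reflected interference: beamformed with probability
`ϑ / 2π`, scattered with probability `1 - ϑ / 2π`. -/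
def reflPowerLaw : Measure ℝ :=
  ENNReal.ofReal (p.beam / (2 * Real.pi)) • p.beamPowerLaw +
    ENNReal.ofReal (1 - p.beam / (2 * Real.pi)) • p.scatterPowerLaw

/-- Laplace transform of `γ_{S_R}`. -/
def beamLaplace (s : ℂ) : ℂ := ∫ t : ℝ, Complex.exp (-s * (t : ℂ)) ∂p.beamPowerLaw

/-! ### Path loss -/

/-- Path loss `g d = β (d + 1) ^ (-α)`. -/
def pathLoss (d : ℝ) : ℝ := p.β * (d + 1) ^ (-p.α)

/-- Multiplicative path loss `G(𝐱, 𝐲) = g(‖𝐲‖) g(‖𝐱 - 𝐲‖)` from the BS at `𝐱` via the RIS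
at `𝐲` to the user at the origin. -/
def reflLoss (a y : Plane) : ℝ := p.pathLoss ‖y‖ * p.pathLoss ‖a - y‖

/-- `𝒢(x, y, ψ) = g(y) g(√(x² + y² - 2 x y cos ψ))`. -/
def reflLossPolar (x y ψ : ℝ) : ℝ :=
  p.pathLoss y * p.pathLoss (Real.sqrt (x ^ 2 + y ^ 2 - 2 * x * y * Real.cos ψ))

/-! ### One cell -/

/-- The annulus `D(R_in, R_out)` centred at the origin. -/
def annulus : Set Plane := {u | p.Rin ≤ ‖u‖ ∧ ‖u‖ ≤ p.Rout}

/-- Randomness attached to one BS: the number of its RISs, their displacements from the BS, the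
fading power of the direct link, and the fading powers of the reflected links. (Only the first
`n` RISs exist if the number of RISs is `n`.) -/
abbrev CellMark : Type := ℕ × (ℕ → Plane) × ℝ × (ℕ → ℝ)

/-- Law of the randomness of one cell. The cluster is Poisson: its number of points is Poisson of
mean `λ_RIS π (R_out² - R_in²)` and its points are i.i.d. uniform on the annulus around the BS. The
direct fading power is `Exp(1)`, the reflected fading powers are i.i.d. copies of `γ_{I_R}`;
all these variables are independent. -/
def cellMarkLaw : Measure CellMark :=
  (poissonMeasure (p.densRIS * Real.pi * (p.Rout ^ 2 - p.Rin ^ 2)).toNNReal).prod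
    ((Measure.infinitePi fun _ : ℕ => (volume : Measure Plane)[|p.annulus]).prod
      ((expMeasure 1).prod (Measure.infinitePi fun _ : ℕ => p.reflPowerLaw)))

/-- Interference power `Q_c` from the cell whose BS is at `a`: direct interference plus the
reflections by the RISs, the `j`-th of which is at `a + u j`. -/
def cellPower (a : Plane) : CellMark → ℝ
  | (n, u, γD, γR) =>
    γD * p.P₀ * p.pathLoss ‖a‖ +
      ∑ j ∈ Finset.range n, γR j * p.P₀ * p.reflLoss a (a + u j)

/-- Laplace transform of the scaled interference power `T Q_c` from a cell with BS at `a`. -/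
def cellLaplace (a : Plane) (s : ℂ) : ℂ :=
  ∫ m, Complex.exp (-s * ((p.T * p.cellPower a m : ℝ) : ℂ)) ∂p.cellMarkLaw

end NetworkParams

/-! ### The network -/

/-- Number of indices `i` for which the random point `x i` lies in `A`. -/
def pointCount {Ω : Type*} (x : ℕ → Ω → Plane) (A : Set Plane) (ω : Ω) : ℕ∞ :=
  {i | x i ω ∈ A}.encard

/-- The random points `x 0, x 1, …`, in whatever order, form a Poisson point process with intensity
measure `Λ`: the number of points in a set of finite intensity is Poisson, and the numbers of
points in pairwise disjoint sets are independent. -/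
structure IsPoissonProcess {Ω : Type*} [MeasurableSpace Ω] (x : ℕ → Ω → Plane)
    (Λ : Measure Plane) (μ : Measure Ω) : Prop where
  measurable : ∀ i, Measurable (x i)
  hasLaw_count : ∀ A : Set Plane, MeasurableSet A → Λ A ≠ ∞ →
    HasLaw (pointCount x A) ((poissonMeasure (Λ A).toNNReal).map (fun n : ℕ => (n : ℕ∞))) μ
  indep_count : ∀ (k : ℕ) (A : Fin k → Set Plane), (∀ l, MeasurableSet (A l)) →
    Pairwise (fun l l' => Disjoint (A l) (A l')) → iIndepFun (fun l => pointCount x (A l)) μ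

/-- The random network: BSs form a homogeneous Poisson point process on the plane, and every
BS carries independently a cell mark (RIS cluster and fadings). The user at the
origin is served by a nearest BS. -/
structure RISNetwork (p : NetworkParams) {Ω : Type*} [MeasurableSpace Ω] (μ : Measure Ω) where
  /-- locations of the BSs -/
  bs : ℕ → Ω → Plane
  /-- marks of the cells -/
  mark : ℕ → Ω → NetworkParams.CellMark
  /-- index `o` of the serving BS -/
  serving : Ω → ℕ
  poisson_bs : IsPoissonProcess bs (ENNReal.ofReal p.densBS • (volume : Measure Plane)) μ
  measurable_mark : ∀ i, Measurable (mark i)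
  hasLaw_mark : ∀ i, HasLaw (mark i) p.cellMarkLaw μ
  indep_mark : iIndepFun mark μ
  indep_bs_mark : IndepFun (fun ω i => bs i ω) (fun ω i => mark i ω) μ
  measurable_serving : Measurable serving
  serving_nearest : ∀ᵐ ω ∂μ, ∀ i, ‖bs (serving ω) ω‖ ≤ ‖bs i ω‖

namespace RISNetwork

variable {p : NetworkParams} {Ω : Type*} [MeasurableSpace Ω] {μ : Measure Ω}
  (N : RISNetwork p μ)

/-- Distance `r = ‖𝐱_o‖` from the user to its serving BS. -/
def servingDist (ω : Ω) : ℝ := ‖N.bs (N.serving ω) ω‖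

/-- Power received from the `i`-th cell as interference: zero for the serving cell. -/
def interferer (i : ℕ) (ω : Ω) : ℝ :=
  if i = N.serving ω then 0 else p.cellPower (N.bs i ω) (N.mark i ω)

/-- Aggregate interference power `Q_I = ∑_{i ≠ o} Q_{c_i}`. -/
def interference (ω : Ω) : ℝ := ∑' i, N.interferer i ω

end RISNetwork

end

/-! ### Laplace transforms of the fading powers -/

/-! One cell: given the number of RISs, the cell power is a sum of independent terms, so its Laplace
transform is the direct exponential factor times the `n`-th power of an average over the annulus.
The Poisson generating function turns that power into the exponential of an integral over the
annulus. The annulus area cancels between the Poisson mean and the uniform law, the mixture law of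
the reflected power splits the integral in two, and polar coordinates around the BS give the stated
form (`cellLaplace_eq`). The result depends on the BS only through its norm.

The network: `integral_finprod_mark` is the generating functional of an independently marked Poisson
process. No conditional point process is constructed. Instead, the functional is applied to a test
function that vanishes on the ball of radius `a`. The product is then zero unless the serving
distance `r` exceeds `a`, so the functional computes the expectation of `exp (-s T Q)` on `{r > a}`,
where `Q` is the power from cells farther than `b ≥ a`. It factors as `P(r > a)` times a function
`tailLaplace` of `b` (`setIntegral_tail_gt`). Subtraction gives the same factorization on `{a < r ≤
b}`. Rounding `r` up to a grid and refining the grid replaces `b` by `r` itself, because both sides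
are right-continuous in the cutoff. Half-lines generate the Borel sets, which identifies the
conditional expectation.

Two almost sure facts link this to the model. Distances to the origin have no ties (`ae_norm_ne`),
so the interferers are exactly the cells strictly farther than `r`. The series converges by
Campbell's formula: a cell at `a` contributes at most `pathLoss ‖a‖` times an integrable variable of
its mark, and the path loss is integrable over the plane because `α > 2`. -/

/-- Both arguments lie in `(-π/2, π/2)`, so their sum stays in the principal strip. This allows the
two Gaussian square roots to be merged into one principal root of the product. -/
theorem Complex.mul_cpow_of_re_pos {z w : ℂ} (hz : 0 < z.re) (hw : 0 < w.re) (r : ℂ) :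
    (z * w) ^ r = z ^ r * w ^ r := by
  have hz0 : z ≠ 0 := fun h => by simp [h] at hz
  have hw0 : w ≠ 0 := fun h => by simp [h] at hw
  have h1 := abs_lt.1 (Complex.abs_arg_lt_pi_div_two_iff.2 (Or.inl hz))
  have h2 := abs_lt.1 (Complex.abs_arg_lt_pi_div_two_iff.2 (Or.inl hw))
  rw [Complex.cpow_def_of_ne_zero (mul_ne_zero hz0 hw0), Complex.cpow_def_of_ne_zero hz0,
    Complex.cpow_def_of_ne_zero hw0,
    (Complex.log_mul_eq_add_log_iff hz0 hw0).2 ⟨by linarith [h1.1, h2.1], by linarith [h1.2, h2.2]⟩,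
    add_mul, Complex.exp_add]

/-- Completing the square reduces this to the complex Gaussian integral. With `w = 1 + 2 s v`, the
condition `0 < w.re` gives convergence and keeps the principal root multiplicative. -/
theorem integral_cexp_neg_mul_sq_gaussianReal (m : ℝ) (v : ℝ≥0) {s : ℂ} (hs : 0 ≤ s.re) :
    ∫ x : ℝ, Complex.exp (-s * (x : ℂ) ^ 2) ∂gaussianReal m v =
      Complex.exp (-((m : ℂ) ^ 2 * s / (1 + 2 * s * (v : ℝ)))) /
        (1 + 2 * s * (v : ℝ)) ^ (1 / 2 : ℂ) := by
  -- The degenerate law is a Dirac mass. It does occur: `varIm = 0` when `M = Mo`.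
  by_cases hv : v = 0
  · subst hv
    rw [gaussianReal_zero_var, integral_dirac]
    simp only [NNReal.coe_zero, Complex.ofReal_zero, mul_zero, add_zero, Complex.one_cpow, div_one]
    congr 1; ring
  have hvpos : (0 : ℝ) < v := by positivity
  have hvne : ((v : ℝ) : ℂ) ≠ 0 := by exact_mod_cast hvpos.ne'
  set w : ℂ := 1 + 2 * s * (v : ℝ) with hw
  have hwre : 0 < w.re := by
    have : w.re = 1 + 2 * s.re * v := by simp [hw]
    rw [this]; positivity
  have hw0 : w ≠ 0 := fun h => by simp [h] at hwre
  have hb : (-w / (2 * (v : ℝ)) : ℂ).re < 0 := by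
    have : (-w / (2 * (v : ℝ)) : ℂ) = (((2 * v)⁻¹ : ℝ) : ℂ) * (-w) := by
      push_cast; field_simp
    rw [this, Complex.re_ofReal_mul, Complex.neg_re]
    have : 0 < (2 * (v : ℝ))⁻¹ := by positivity
    nlinarith
  calc ∫ x : ℝ, Complex.exp (-s * (x : ℂ) ^ 2) ∂gaussianReal m v
      = ∫ x : ℝ, (gaussianPDFReal m v x : ℂ) * Complex.exp (-s * (x : ℂ) ^ 2) := by
        simp_rw [integral_gaussianReal_eq_integral_smul hv, Complex.real_smul]
    _ = (Real.sqrt (2 * Real.pi * v))⁻¹ * ∫ x : ℝ, Complex.exp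
          (-w / (2 * (v : ℝ)) * (x : ℂ) ^ 2 + (m / (v : ℝ)) * x + -(m : ℂ) ^ 2 / (2 * (v : ℝ))) := by
        rw [← integral_const_mul]
        congr with x
        rw [gaussianPDFReal]
        push_cast
        rw [mul_assoc, ← Complex.exp_add]
        congr 2
        rw [hw]; field_simp; ring
    _ = (Real.sqrt (2 * Real.pi * v))⁻¹ * ((Real.pi / -(-w / (2 * (v : ℝ)))) ^ (1 / 2 : ℂ) *
          Complex.exp (-(m : ℂ) ^ 2 / (2 * (v : ℝ)) - (m / (v : ℝ)) ^ 2 /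
            (4 * (-w / (2 * (v : ℝ)))))) := by
        rw [integral_cexp_quadratic hb]
    _ = _ := by
        have e1 : (Real.pi / -(-w / (2 * (v : ℝ))) : ℂ) = ((2 * Real.pi * v : ℝ) : ℂ) * w⁻¹ := by
          push_cast; field_simp
        have e2 : -(m : ℂ) ^ 2 / (2 * (v : ℝ)) - (m / (v : ℝ)) ^ 2 / (4 * (-w / (2 * (v : ℝ)))) =
            -((m : ℂ) ^ 2 * s / w) := by
          -- Eliminating `s` in favour of `w` leaves a rational identity in `m`, `v`, `w`.
          have : s = (w - 1) / (2 * (v : ℝ)) := by rw [hw]; field_simp; ring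
          rw [this]; field_simp; ring
        have e3 : w.arg ≠ Real.pi := by
          intro h
          have := abs_lt.1 (Complex.abs_arg_lt_pi_div_two_iff.2 (Or.inl hwre))
          linarith [Real.pi_pos]
        have hpos : 0 < 2 * Real.pi * (v : ℝ) := by positivity
        have hwi : 0 < (w⁻¹).re := by
          rw [Complex.inv_re]; exact div_pos hwre (Complex.normSq_pos.2 hw0)
        rw [e1, e2, Complex.mul_cpow_of_re_pos (by rwa [Complex.ofReal_re]) hwi,
          Complex.inv_cpow _ _ e3]
        have e4 : (((2 * Real.pi * v : ℝ) : ℂ)) ^ (1 / 2 : ℂ) = (Real.sqrt (2 * Real.pi * v) : ℂ) := by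
          rw [Real.sqrt_eq_rpow, Complex.ofReal_cpow hpos.le]; push_cast; rfl
        rw [e4]
        have : (Real.sqrt (2 * Real.pi * v) : ℂ) ≠ 0 := by
          exact_mod_cast (Real.sqrt_pos.2 hpos).ne'
        push_cast at this ⊢
        field_simp

theorem expMeasure_one_eq : expMeasure 1 =
    (volume.restrict (Ici (0 : ℝ))).withDensity (fun x => ENNReal.ofReal (Real.exp (-x))) := by
  rw [← withDensity_indicator measurableSet_Ici]
  change volume.withDensity (exponentialPDF 1) = _
  congr 1
  ext x
  rw [exponentialPDF_eq]
  by_cases h : 0 ≤ x <;> simp [h]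

theorem ae_nonneg_expMeasure : ∀ᵐ x ∂expMeasure 1, 0 ≤ x := by
  rw [expMeasure_one_eq]
  exact (withDensity_absolutelyContinuous _ _).ae_le (ae_restrict_mem measurableSet_Ici)

theorem integrable_id_expMeasure : Integrable (fun x : ℝ => x) (expMeasure 1) := by
  rw [expMeasure_one_eq, integrable_withDensity_iff (by fun_prop) (by simp)]
  have h := Real.GammaIntegral_convergent (s := 2) (by norm_num)
  rw [← IntegrableOn, integrableOn_Ici_iff_integrableOn_Ioi]
  refine h.congr_fun (fun x hx => ?_) measurableSet_Ioi
  have h2 : (2 : ℝ) - 1 = 1 := by norm_num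
  simp only [h2, Real.rpow_one]
  rw [ENNReal.toReal_ofReal (Real.exp_pos _).le, mul_comm]

theorem integral_cexp_neg_mul_expMeasure {s : ℂ} (hs : 0 ≤ s.re) :
    ∫ x : ℝ, Complex.exp (-s * (x : ℂ)) ∂expMeasure 1 = 1 / (1 + s) := by
  rw [expMeasure_one_eq, integral_withDensity_eq_integral_toReal_smul (by fun_prop) (by simp),
    integral_Ici_eq_integral_Ioi]
  have h : ∀ x : ℝ, (ENNReal.ofReal (Real.exp (-x))).toReal • Complex.exp (-s * (x : ℂ)) =
      Complex.exp ((-(1 + s)) * (x : ℂ)) := by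
    intro x
    rw [ENNReal.toReal_ofReal (Real.exp_pos _).le, Complex.real_smul, Complex.ofReal_exp,
      ← Complex.exp_add]
    congr 1; push_cast; ring
  simp_rw [h]
  rw [integral_exp_mul_complex_Ioi (by simp; linarith)]
  rw [Complex.ofReal_zero, mul_zero, Complex.exp_zero, neg_div_neg_eq]

namespace NetworkParams

variable (p : NetworkParams)

theorem zetaVar_nonneg : 0 ≤ p.zetaVar := variance_nonneg _ _

theorem varRe_nonneg : 0 ≤ p.varRe := mul_nonneg (by positivity) p.zetaVar_nonneg

theorem M_sub_Mo_nonneg : 0 ≤ (p.M : ℝ) - p.Mo := by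
  have : (p.Mo : ℝ) ≤ p.M := by exact_mod_cast p.Mo_le_M
  linarith

theorem varIm_nonneg : 0 ≤ p.varIm :=
  mul_nonneg (div_nonneg p.M_sub_Mo_nonneg (by norm_num)) p.zetaVar_nonneg

instance : IsProbabilityMeasure (expMeasure 1) := isProbabilityMeasure_expMeasure one_pos

instance : IsProbabilityMeasure p.beamPowerLaw :=
  Measure.isProbabilityMeasure_map (by fun_prop)

instance : IsProbabilityMeasure p.scatterPowerLaw :=
  Measure.isProbabilityMeasure_map (by fun_prop)

theorem beam_div_nonneg : 0 ≤ p.beam / (2 * Real.pi) :=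
  div_nonneg p.beam_nonneg (by positivity)

theorem beam_div_le_one : p.beam / (2 * Real.pi) ≤ 1 :=
  (div_le_one (by positivity)).2 p.beam_le

instance : IsProbabilityMeasure p.reflPowerLaw where
  measure_univ := by
    simp only [reflPowerLaw, Measure.coe_add, Measure.coe_smul, Pi.add_apply, Pi.smul_apply,
      measure_univ, smul_eq_mul, mul_one]
    rw [← ENNReal.ofReal_add p.beam_div_nonneg (by linarith [p.beam_div_le_one])]
    simp

theorem ae_nonneg_beamPowerLaw : ∀ᵐ t ∂p.beamPowerLaw, 0 ≤ t := by
  rw [beamPowerLaw, ae_map_iff (by fun_prop) measurableSet_Ici]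
  exact Filter.Eventually.of_forall fun q => by positivity

theorem ae_nonneg_scatterPowerLaw : ∀ᵐ t ∂p.scatterPowerLaw, 0 ≤ t := by
  rw [scatterPowerLaw, ae_map_iff (by fun_prop) measurableSet_Ici]
  filter_upwards [ae_nonneg_expMeasure] with t ht using mul_nonneg p.M_sub_Mo_nonneg ht

theorem ae_nonneg_reflPowerLaw : ∀ᵐ t ∂p.reflPowerLaw, 0 ≤ t := by
  rw [reflPowerLaw, ae_add_measure_iff]
  exact ⟨Measure.ae_smul_measure p.ae_nonneg_beamPowerLaw _,
    Measure.ae_smul_measure p.ae_nonneg_scatterPowerLaw _⟩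

theorem integrable_sq_gaussianReal (m : ℝ) (v : ℝ≥0) :
    Integrable (fun x : ℝ => x ^ 2) (gaussianReal m v) :=
  (memLp_id_gaussianReal' 2 (by simp)).integrable_sq

theorem integrable_id_reflPowerLaw : Integrable (fun t : ℝ => t) p.reflPowerLaw := by
  refine Integrable.add_measure (Integrable.smul_measure ?_ (by simp))
    (Integrable.smul_measure ?_ (by simp))
  · rw [beamPowerLaw, integrable_map_measure (by fun_prop) (by fun_prop)]
    exact ((integrable_sq_gaussianReal _ _).comp_fst _).add
      ((integrable_sq_gaussianReal _ _).comp_snd _)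
  · rw [scatterPowerLaw, integrable_map_measure (by fun_prop) (by fun_prop)]
    exact integrable_id_expMeasure.const_mul _

theorem beamLaplace_eq {s : ℂ} (hs : 0 ≤ s.re) : p.beamLaplace s =
    Complex.exp (-((p.muRe : ℂ) ^ 2 * s / (1 + 2 * s * p.varRe))) /
      ((1 + 2 * s * p.varRe) * (1 + 2 * s * p.varIm)) ^ (1 / 2 : ℂ) := by
  rw [beamLaplace, beamPowerLaw, integral_map (by fun_prop) (by fun_prop)]
  have h : ∀ q : ℝ × ℝ, Complex.exp (-s * ((q.1 ^ 2 + q.2 ^ 2 : ℝ) : ℂ)) =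
      Complex.exp (-s * (q.1 : ℂ) ^ 2) * Complex.exp (-s * (q.2 : ℂ) ^ 2) := by
    intro q; rw [← Complex.exp_add]; congr 1; push_cast; ring
  simp_rw [h]
  rw [integral_prod_mul (fun x : ℝ => Complex.exp (-s * (x : ℂ) ^ 2))
      (fun x : ℝ => Complex.exp (-s * (x : ℂ) ^ 2)),
    integral_cexp_neg_mul_sq_gaussianReal _ _ hs, integral_cexp_neg_mul_sq_gaussianReal _ _ hs,
    Real.coe_toNNReal _ p.varRe_nonneg, Real.coe_toNNReal _ p.varIm_nonneg,
    Complex.mul_cpow_of_re_pos]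
  · simp only [Complex.ofReal_zero, ne_eq, OfNat.ofNat_ne_zero, not_false_eq_true, zero_pow,
      zero_mul, zero_div, neg_zero, Complex.exp_zero]
    rw [div_mul_div_comm, mul_one]
  · have := p.varRe_nonneg
    simp; positivity
  · have := p.varIm_nonneg
    simp; positivity

theorem norm_cexp_neg_mul_le_one {s : ℂ} (hs : 0 ≤ s.re) {t : ℝ} (ht : 0 ≤ t) :
    ‖Complex.exp (-s * (t : ℂ))‖ ≤ 1 := by
  rw [Complex.norm_exp]
  simpa using mul_nonneg hs ht

theorem integrable_cexp_neg_mul {ν : Measure ℝ} [IsFiniteMeasure ν] (hν : ∀ᵐ t ∂ν, 0 ≤ t) {s : ℂ}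
    (hs : 0 ≤ s.re) : Integrable (fun t : ℝ => Complex.exp (-s * (t : ℂ))) ν :=
  Integrable.of_bound (by fun_prop) 1 <| hν.mono fun _ ht => norm_cexp_neg_mul_le_one hs ht

theorem integral_cexp_neg_mul_scatterPowerLaw {s : ℂ} (hs : 0 ≤ s.re) :
    ∫ t : ℝ, Complex.exp (-s * (t : ℂ)) ∂p.scatterPowerLaw =
      1 / (1 + s * ((p.M : ℂ) - p.Mo)) := by
  rw [scatterPowerLaw, integral_map (by fun_prop) (by fun_prop)]
  rw [← integral_cexp_neg_mul_expMeasure]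
  · congr with t; congr 1; push_cast; ring
  · have := mul_nonneg hs p.M_sub_Mo_nonneg
    simpa using this

theorem integral_cexp_neg_mul_reflPowerLaw {s : ℂ} (hs : 0 ≤ s.re) :
    ∫ t : ℝ, Complex.exp (-s * (t : ℂ)) ∂p.reflPowerLaw =
      (p.beam / (2 * Real.pi) : ℝ) * p.beamLaplace s +
        (1 - p.beam / (2 * Real.pi) : ℝ) * (1 / (1 + s * ((p.M : ℂ) - p.Mo))) := by
  rw [reflPowerLaw, integral_add_measure, integral_smul_measure, integral_smul_measure,
    integral_cexp_neg_mul_scatterPowerLaw p hs, ENNReal.toReal_ofReal p.beam_div_nonneg,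
    ENNReal.toReal_ofReal (by linarith [p.beam_div_le_one]), Complex.real_smul, Complex.real_smul,
    beamLaplace]
  · exact (integrable_cexp_neg_mul p.ae_nonneg_beamPowerLaw hs).smul_measure (by simp)
  · exact (integrable_cexp_neg_mul p.ae_nonneg_scatterPowerLaw hs).smul_measure (by simp)

end NetworkParams

/-! ### Integration over an annulus in polar coordinates -/

/-- The law of cosines for the triangle with vertices `0`, `w` and the translated point. The angle
is measured from the direction of `-w`, whence the shift by `π` and the minus sign under the root.
The shift disappears after integration over a full period. -/
theorem norm_add_polarCoord_symm (w : ℂ) (r θ : ℝ) :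
    ‖w + Complex.polarCoord.symm (r, θ)‖ =
      Real.sqrt (‖w‖ ^ 2 + r ^ 2 - 2 * ‖w‖ * r * Real.cos (θ - (w.arg + Real.pi))) := by
  have h1 : Real.cos (θ - (w.arg + Real.pi)) = -Real.cos (θ - w.arg) := by
    rw [← sub_sub, Real.cos_sub_pi]
  rw [h1, Real.cos_sub, ← Real.sqrt_sq (norm_nonneg (w + _)), ← Complex.normSq_eq_norm_sq,
    ← Complex.normSq_eq_norm_sq]
  congr 1
  have h2 := Complex.norm_mul_cos_arg w
  have h3 := Complex.norm_mul_sin_arg w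
  have h4 := Real.sin_sq_add_cos_sq θ
  rw [Complex.polarCoord_symm_apply, Complex.normSq_apply, Complex.normSq_apply]
  simp only [Complex.add_re, Complex.mul_re, Complex.ofReal_re, Complex.ofReal_im,
    Complex.I_re, Complex.I_im, Complex.add_im, Complex.mul_im]
  linear_combination (-2 * r * Real.cos θ) * h2 + (-2 * r * Real.sin θ) * h3 + r ^ 2 * h4

namespace NetworkParams

variable (p : NetworkParams)

theorem measurableSet_annulus : MeasurableSet p.annulus :=
  (measurableSet_le measurable_const measurable_norm).inter
    (measurableSet_le measurable_norm measurable_const)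

theorem annulus_eq : p.annulus = Metric.closedBall 0 p.Rout \ Metric.ball 0 p.Rin := by
  ext u; simp [annulus, and_comm]

theorem volume_annulus : (volume : Measure Plane).real p.annulus =
    Real.pi * (p.Rout ^ 2 - p.Rin ^ 2) := by
  have hR : 0 ≤ p.Rout := p.Rin_nonneg.trans p.Rin_lt_Rout.le
  rw [annulus_eq, measureReal_sdiff (Metric.ball_subset_closedBall.trans
      (Metric.closedBall_subset_closedBall p.Rin_lt_Rout.le)) measurableSet_ball
      measure_closedBall_lt_top.ne,
    measureReal_def, measureReal_def, EuclideanSpace.volume_closedBall_fin_two,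
    EuclideanSpace.volume_ball_fin_two]
  simp [ENNReal.toReal_ofReal hR, ENNReal.toReal_ofReal p.Rin_nonneg, Real.pi_pos.le]
  ring

theorem area_pos : 0 < Real.pi * (p.Rout ^ 2 - p.Rin ^ 2) := by
  have := p.Rin_lt_Rout
  have := p.Rin_nonneg
  exact mul_pos Real.pi_pos (by nlinarith)

theorem volume_annulus_ne_top : (volume : Measure Plane) p.annulus ≠ ∞ := by
  rw [annulus_eq]
  exact ((measure_mono sdiff_subset).trans_lt measure_closedBall_lt_top).ne

theorem volume_annulus_ne_zero : (volume : Measure Plane) p.annulus ≠ 0 := by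
  intro h
  have := p.volume_annulus
  rw [measureReal_def, h] at this
  exact p.area_pos.ne (by simpa using this)

/-- The bound on `K` is required at nonnegative arguments only, since the Laplace transforms to be
inserted are controlled only on the right half-plane. -/
theorem setIntegral_annulus {K : ℝ → ℝ → ℂ} (hK : Measurable (Function.uncurry K)) {C : ℝ}
    (hC : ∀ y z, 0 ≤ y → 0 ≤ z → ‖K y z‖ ≤ C) (a : Plane) :
    ∫ u in p.annulus, K ‖u‖ ‖a + u‖ = ∫ ψ in (0 : ℝ)..(2 * Real.pi), ∫ y in p.Rin..p.Rout,
      (y : ℂ) * K y (Real.sqrt (‖a‖ ^ 2 + y ^ 2 - 2 * ‖a‖ * y * Real.cos ψ)) := by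
  set e : ℂ ≃ₗᵢ[ℝ] Plane := Complex.orthonormalBasisOneI.repr
  set w := e.symm a with hw
  have hnw : ‖w‖ = ‖a‖ := e.symm.norm_map a
  have hC0 : 0 ≤ C := (norm_nonneg _).trans (hC 0 0 le_rfl le_rfl)
  -- The inner sphere is null. Dropping it matches the half-open interval integrals and excludes
  -- radius `0`, where polar coordinates degenerate.
  have h1 : p.annulus =ᵐ[volume] {u : Plane | ‖u‖ ∈ Ioc p.Rin p.Rout} := by
    have h0 : (volume : Measure Plane) (Metric.sphere 0 p.Rin) = 0 :=
      Measure.addHaar_sphere _ _ _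
    filter_upwards [compl_mem_ae_iff.2 h0] with u hu
    have hu' : ‖u‖ ≠ p.Rin := by simpa using hu
    apply propext
    exact ⟨fun h => ⟨lt_of_le_of_ne h.1 hu'.symm, h.2⟩, fun h => ⟨h.1.le, h.2⟩⟩
  have hms : MeasurableSet {u : Plane | ‖u‖ ∈ Ioc p.Rin p.Rout} := measurable_norm measurableSet_Ioc
  set h : ℝ × ℝ → ℂ := fun q => (q.1 : ℂ) * K q.1 (Real.sqrt (‖a‖ ^ 2 + q.1 ^ 2 -
    2 * ‖a‖ * q.1 * Real.cos (q.2 - (w.arg + Real.pi)))) with hh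
  set q : ℝ → ℂ := fun ψ => ∫ y in p.Rin..p.Rout,
    (y : ℂ) * K y (Real.sqrt (‖a‖ ^ 2 + y ^ 2 - 2 * ‖a‖ * y * Real.cos ψ)) with hq
  have hhm : Measurable h := by
    exact Measurable.mul (by fun_prop) (hK.comp (g := Function.uncurry K)
      (f := fun q : ℝ × ℝ => (q.1, Real.sqrt (‖a‖ ^ 2 + q.1 ^ 2 -
        2 * ‖a‖ * q.1 * Real.cos (q.2 - (w.arg + Real.pi))))) (by fun_prop))
  have hint : IntegrableOn h (Ioc p.Rin p.Rout ×ˢ Ioo (-Real.pi) Real.pi)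
      (volume.prod volume) := by
    refine Measure.integrableOn_of_bounded (M := p.Rout * C) ?_ hhm.aestronglyMeasurable ?_
    · rw [Measure.prod_prod]
      exact ENNReal.mul_ne_top (by simp) (by simp)
    · refine (ae_restrict_mem (measurableSet_Ioc.prod measurableSet_Ioo)).mono fun x hx => ?_
      have hx1 : p.Rin < x.1 ∧ x.1 ≤ p.Rout := hx.1
      have hx0 : 0 ≤ x.1 := p.Rin_nonneg.trans hx1.1.le
      rw [hh, norm_mul, Complex.norm_real, Real.norm_of_nonneg hx0]
      exact mul_le_mul hx1.2 (hC _ _ hx0 (Real.sqrt_nonneg _)) (norm_nonneg _)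
        (hx0.trans hx1.2)
  calc ∫ u in p.annulus, K ‖u‖ ‖a + u‖
      = ∫ u : Plane, {u : Plane | ‖u‖ ∈ Ioc p.Rin p.Rout}.indicator
          (fun u => K ‖u‖ ‖a + u‖) u := by
        rw [setIntegral_congr_set h1, integral_indicator hms]
    _ = ∫ z : ℂ, {z : ℂ | ‖z‖ ∈ Ioc p.Rin p.Rout}.indicator (fun z => K ‖z‖ ‖w + z‖) z := by
        rw [← e.measurePreserving.integral_comp e.toHomeomorph.measurableEmbedding]
        congr with z
        have : ‖a + e z‖ = ‖w + z‖ := by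
          rw [← e.norm_map (w + z), map_add, hw, e.apply_symm_apply]
        simp only [indicator, mem_ofPred_eq, e.norm_map, this]
    _ = ∫ x in polarCoord.target, (Ioc p.Rin p.Rout ×ˢ univ).indicator h x := by
        rw [← Complex.integral_comp_polarCoord_symm]
        refine setIntegral_congr_fun polarCoord.open_target.measurableSet fun x hx => ?_
        rw [polarCoord_target] at hx
        have hx0 : 0 < x.1 := hx.1
        have hn : ‖Complex.polarCoord.symm x‖ = x.1 := by
          rw [Complex.norm_polarCoord_symm, abs_of_pos hx0]
        simp only [indicator, mem_ofPred_eq, mem_prod, mem_univ, and_true, hn]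
        split_ifs with h2
        · rw [Complex.real_smul, norm_add_polarCoord_symm w x.1 x.2, hnw]
        · simp
    _ = ∫ x in Ioc p.Rin p.Rout ×ˢ Ioo (-Real.pi) Real.pi, h x := by
        rw [setIntegral_indicator (measurableSet_Ioc.prod MeasurableSet.univ)]
        congr 2
        rw [polarCoord_target, prod_inter_prod, inter_univ]
        congr 1
        exact inter_eq_right.2 fun x hx => lt_of_le_of_lt p.Rin_nonneg hx.1
    _ = ∫ θ in Ioo (-Real.pi) Real.pi, ∫ y in Ioc p.Rin p.Rout, h (y, θ) := by
        rw [Measure.volume_eq_prod, ← setIntegral_prod_swap, setIntegral_prod]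
        · rfl
        · exact hint.swap
    _ = ∫ θ in (-Real.pi)..Real.pi, q (θ - (w.arg + Real.pi)) := by
        rw [intervalIntegral.integral_of_le (by linarith [Real.pi_pos]),
          integral_Ioc_eq_integral_Ioo]
        simp only [hq, hh]
        simp_rw [intervalIntegral.integral_of_le p.Rin_lt_Rout.le]
    _ = ∫ ψ in (0 : ℝ)..(2 * Real.pi), q ψ := by
        have hper : Function.Periodic q (2 * Real.pi) := fun ψ => by
          simp only [hq, Real.cos_add_two_pi]
        rw [intervalIntegral.integral_comp_sub_right]
        have := hper.intervalIntegral_add_eq (-Real.pi - (w.arg + Real.pi)) 0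
        rw [zero_add] at this
        rw [← this]
        congr 1; ring

end NetworkParams

/-! ### The interference from one cell -/

theorem integral_prod_infinitePi {X : Type*} [MeasurableSpace X] (ν : ℕ → Measure X)
    [∀ i, IsProbabilityMeasure (ν i)] (n : ℕ) {f : ℕ → X → ℂ} (hf : ∀ i, Measurable (f i)) :
    ∫ x, ∏ j ∈ Finset.range n, f j (x j) ∂Measure.infinitePi ν =
      ∏ j ∈ Finset.range n, ∫ y, f j y ∂ν j := by
  have h := integral_restrict_infinitePi (μ := ν) (s := Finset.range n)
    (f := fun y => ∏ j : Finset.range n, f j (y j)) (Measurable.aestronglyMeasurable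
      (Finset.measurable_prod _ fun j _ => (hf j).comp (measurable_pi_apply j)))
  rw [integral_fintype_prod_eq_prod (fun j : Finset.range n => f j)] at h
  rw [← Finset.prod_coe_sort _ (fun j => ∫ y, f j y ∂ν j), ← h]
  congr with x
  rw [← Finset.prod_coe_sort]
  rfl

theorem integral_pow_poissonMeasure (r : ℝ≥0) (z : ℂ) :
    ∫ n, z ^ n ∂poissonMeasure r = Complex.exp (-((r : ℝ) * (1 - z))) := by
  rw [integral_poissonMeasure]
  have h : ∀ n : ℕ, (Real.exp (-r) * r ^ n / n.factorial) • z ^ n =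
      Complex.exp (-(r : ℝ)) * (((r : ℝ) * z) ^ n / n.factorial) := by
    intro n
    rw [Complex.real_smul, mul_pow]; push_cast; ring
  simp_rw [h]
  rw [tsum_mul_left, (NormedSpace.expSeries_div_hasSum_exp (((r : ℝ) : ℂ) * z)).tsum_eq,
    ← Complex.exp_eq_exp_ℂ, ← Complex.exp_add]
  congr 1; ring

namespace NetworkParams

variable (p : NetworkParams)

theorem pathLoss_nonneg {d : ℝ} (hd : 0 ≤ d) : 0 ≤ p.pathLoss d :=
  mul_nonneg p.β_pos.le (Real.rpow_nonneg (by linarith) _)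

@[fun_prop]
theorem measurable_pathLoss : Measurable p.pathLoss := by
  unfold pathLoss; fun_prop

theorem reflLoss_nonneg (a y : Plane) : 0 ≤ p.reflLoss a y :=
  mul_nonneg (p.pathLoss_nonneg (norm_nonneg _)) (p.pathLoss_nonneg (norm_nonneg _))

@[fun_prop]
theorem measurable_reflLoss {X : Type*} [MeasurableSpace X] {f g : X → Plane} (hf : Measurable f)
    (hg : Measurable g) : Measurable (fun x => p.reflLoss (f x) (g x)) := by
  unfold reflLoss; fun_prop

theorem measurable_cellPower :
    Measurable (fun q : Plane × CellMark => p.cellPower q.1 q.2) := by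
  -- The number of summands is a random natural number, so measurability is checked separately for
  -- each of its countably many values.
  have h : Measurable (fun q : ℕ × Plane × (ℕ → Plane) × ℝ × (ℕ → ℝ) =>
      p.cellPower q.2.1 (q.1, q.2.2)) := by
    refine measurable_from_prod_countable_right fun n => ?_
    simp only [cellPower]
    fun_prop
  exact h.comp (f := fun q : Plane × CellMark => (q.2.1, q.1, q.2.2)) (by fun_prop)

instance : IsProbabilityMeasure ((volume : Measure Plane)[|p.annulus]) :=
  cond_isProbabilityMeasure_of_finite p.volume_annulus_ne_zero p.volume_annulus_ne_top

/-- The law of the displacements and fading powers of one cell. -/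
noncomputable abbrev restLaw : Measure ((ℕ → Plane) × ℝ × (ℕ → ℝ)) :=
  (Measure.infinitePi fun _ : ℕ => (volume : Measure Plane)[|p.annulus]).prod
      ((expMeasure 1).prod (Measure.infinitePi fun _ : ℕ => p.reflPowerLaw))

instance : IsProbabilityMeasure p.cellMarkLaw := by
  unfold cellMarkLaw; infer_instance

theorem ae_restLaw_nonneg : ∀ᵐ m ∂p.restLaw, ∀ n a, 0 ≤ p.cellPower a (n, m) := by
  have h1 : ∀ᵐ m ∂p.restLaw, 0 ≤ m.2.1 :=
    Measure.quasiMeasurePreserving_snd.ae (Measure.quasiMeasurePreserving_fst.ae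
      ae_nonneg_expMeasure)
  have h2 : ∀ᵐ m ∂p.restLaw, ∀ j, 0 ≤ m.2.2 j :=
    Measure.quasiMeasurePreserving_snd.ae (Measure.quasiMeasurePreserving_snd.ae
      (ae_all_iff.2 fun j => (measurePreserving_eval_infinitePi _ j).quasiMeasurePreserving.ae
        p.ae_nonneg_reflPowerLaw))
  filter_upwards [h1, h2] with m hm1 hm2 n a
  have := p.P₀_pos.le
  exact add_nonneg (mul_nonneg (mul_nonneg hm1 this) (p.pathLoss_nonneg (norm_nonneg _)))
    (Finset.sum_nonneg fun j _ => mul_nonneg (mul_nonneg (hm2 j) this) (p.reflLoss_nonneg _ _))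

theorem ae_cellPower_nonneg : ∀ᵐ m ∂p.cellMarkLaw, ∀ a, 0 ≤ p.cellPower a m := by
  have : ∀ᵐ m ∂p.cellMarkLaw, ∀ n a, 0 ≤ p.cellPower a (n, m.2) :=
    Measure.quasiMeasurePreserving_snd.ae p.ae_restLaw_nonneg
  filter_upwards [this] with m hm a using hm m.1 a

theorem norm_cexp_neg_mul_T_le_one {s : ℂ} (hs : 0 ≤ s.re) {t : ℝ} (ht : 0 ≤ t) :
    ‖Complex.exp (-s * ((p.T * t : ℝ) : ℂ))‖ ≤ 1 :=
  norm_cexp_neg_mul_le_one hs (mul_nonneg p.T_pos.le ht)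

theorem norm_cellLaplace_le_one (a : Plane) {s : ℂ} (hs : 0 ≤ s.re) :
    ‖p.cellLaplace a s‖ ≤ 1 := by
  refine (norm_integral_le_of_norm_le_const (C := 1) (p.ae_cellPower_nonneg.mono
    fun m hm => p.norm_cexp_neg_mul_T_le_one hs (hm a))).trans ?_
  simp

/-- Laplace transform of the power reflected by one RIS with displacement `u`. -/
noncomputable def reflLaplace (a : Plane) (s : ℂ) (u : Plane) : ℂ :=
  ∫ t : ℝ, Complex.exp (-(s * p.P₀ * p.T * p.reflLoss a (a + u)) * (t : ℂ)) ∂p.reflPowerLaw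

theorem measurable_reflLaplace (a : Plane) (s : ℂ) : Measurable (p.reflLaplace a s) := by
  refine (StronglyMeasurable.integral_prod_right'
    (f := fun q : Plane × ℝ => Complex.exp (-(s * p.P₀ * p.T * p.reflLoss a (a + q.1)) * (q.2 : ℂ)))
    (Measurable.stronglyMeasurable ?_)).measurable
  fun_prop

/-- The exponential of the sum is a product of functions of independent variables. For fixed
displacements the fadings are integrated out, and the remaining factors are i.i.d. in the
displacements. -/
theorem integral_restLaw (a : Plane) {s : ℂ} (hs : 0 ≤ s.re) (n : ℕ) :
    ∫ m, Complex.exp (-s * ((p.T * p.cellPower a (n, m) : ℝ) : ℂ)) ∂p.restLaw =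
      1 / (1 + s * p.P₀ * p.T * p.pathLoss ‖a‖) *
        (∫ u, p.reflLaplace a s u ∂(volume : Measure Plane)[|p.annulus]) ^ n := by
  have hm : Measurable (fun m => Complex.exp (-s * ((p.T * p.cellPower a (n, m) : ℝ) : ℂ))) := by
    have : Measurable (fun m => p.cellPower a (n, m)) :=
      p.measurable_cellPower.comp (f := fun m => (a, (n, m))) (by fun_prop)
    fun_prop
  have hdirect : ∫ t : ℝ, Complex.exp (-(s * p.P₀ * p.T * p.pathLoss ‖a‖) * (t : ℂ))
      ∂expMeasure 1 = 1 / (1 + s * p.P₀ * p.T * p.pathLoss ‖a‖) := by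
    refine integral_cexp_neg_mul_expMeasure ?_
    have : s * p.P₀ * p.T * p.pathLoss ‖a‖ = s * ((p.P₀ * p.T * p.pathLoss ‖a‖ : ℝ) : ℂ) := by
      push_cast; ring
    rw [this, Complex.re_mul_ofReal]
    exact mul_nonneg hs (mul_nonneg (mul_nonneg p.P₀_pos.le p.T_pos.le)
      (p.pathLoss_nonneg (norm_nonneg _)))
  rw [integral_prod _ (Integrable.of_bound hm.aestronglyMeasurable 1
    (p.ae_restLaw_nonneg.mono fun m hm => p.norm_cexp_neg_mul_T_le_one hs (hm n a)))]
  have key : ∀ u : ℕ → Plane, ∫ z : ℝ × (ℕ → ℝ),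
      Complex.exp (-s * ((p.T * p.cellPower a (n, u, z) : ℝ) : ℂ))
        ∂(expMeasure 1).prod (Measure.infinitePi fun _ : ℕ => p.reflPowerLaw) =
      1 / (1 + s * p.P₀ * p.T * p.pathLoss ‖a‖) *
        ∏ j ∈ Finset.range n, p.reflLaplace a s (u j) := by
    intro u
    have h : ∀ z : ℝ × (ℕ → ℝ), Complex.exp (-s * ((p.T * p.cellPower a (n, u, z) : ℝ) : ℂ)) =
        Complex.exp (-(s * p.P₀ * p.T * p.pathLoss ‖a‖) * (z.1 : ℂ)) *
          ∏ j ∈ Finset.range n,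
            Complex.exp (-(s * p.P₀ * p.T * p.reflLoss a (a + u j)) * (z.2 j : ℂ)) := by
      intro z
      rw [← Complex.exp_sum, ← Complex.exp_add]
      congr 1
      simp only [cellPower]
      push_cast
      rw [mul_add, mul_add, Finset.mul_sum, Finset.mul_sum]
      congr 1
      · ring
      · exact Finset.sum_congr rfl fun j _ => by ring
    simp_rw [h]
    rw [integral_prod_mul
      (fun t : ℝ => Complex.exp (-(s * p.P₀ * p.T * p.pathLoss ‖a‖) * (t : ℂ)))
      (fun y : ℕ → ℝ => ∏ j ∈ Finset.range n,
            Complex.exp (-(s * p.P₀ * p.T * p.reflLoss a (a + u j)) * (y j : ℂ))), hdirect,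
      integral_prod_infinitePi _ n (f := fun j (t : ℝ) =>
        Complex.exp (-(s * p.P₀ * p.T * p.reflLoss a (a + u j)) * (t : ℂ)))
        (fun i => by fun_prop)]
    rfl
  simp_rw [key]
  rw [integral_const_mul, integral_prod_infinitePi _ n (fun _ => p.measurable_reflLaplace a s),
    Finset.prod_const, Finset.card_range]

/-- `integral_pow_poissonMeasure` sums over the number of RISs. The area in the Poisson mean cancels
the normalization of the uniform law, so only `densRIS` remains in front of the integral. -/
theorem cellLaplace_eq_exp (a : Plane) {s : ℂ} (hs : 0 ≤ s.re) : p.cellLaplace a s =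
    1 / (1 + s * p.P₀ * p.T * p.pathLoss ‖a‖) *
      Complex.exp (-(p.densRIS * ∫ u in p.annulus, (1 - p.reflLaplace a s u))) := by
  have hm : Measurable (fun m => Complex.exp (-s * ((p.T * p.cellPower a m : ℝ) : ℂ))) := by
    have : Measurable (fun m => p.cellPower a m) :=
      p.measurable_cellPower.comp (f := fun m => (a, m)) (by fun_prop)
    fun_prop
  rw [cellLaplace, cellMarkLaw, integral_prod _ (Integrable.of_bound hm.aestronglyMeasurable 1
    (p.ae_cellPower_nonneg.mono fun m hm => p.norm_cexp_neg_mul_T_le_one hs (hm a)))]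
  simp_rw [p.integral_restLaw a hs]
  rw [integral_const_mul, integral_pow_poissonMeasure]
  congr 3
  have hA := p.area_pos
  have hb : ∀ u, ‖p.reflLaplace a s u‖ ≤ 1 := by
    intro u
    refine (norm_integral_le_of_norm_le_const (C := 1) (p.ae_nonneg_reflPowerLaw.mono
      fun t ht => norm_cexp_neg_mul_le_one ?_ ht)).trans (by simp)
    have : s * p.P₀ * p.T * p.reflLoss a (a + u) =
        s * ((p.P₀ * p.T * p.reflLoss a (a + u) : ℝ) : ℂ) := by
      push_cast; ring
    rw [this, Complex.re_mul_ofReal]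
    exact mul_nonneg hs (mul_nonneg (mul_nonneg p.P₀_pos.le p.T_pos.le) (p.reflLoss_nonneg _ _))
  have hint : Integrable (p.reflLaplace a s) ((volume : Measure Plane)[|p.annulus]) :=
    Integrable.of_bound (p.measurable_reflLaplace a s).aestronglyMeasurable 1
      (Filter.Eventually.of_forall hb)
  have h1 : 1 - ∫ u, p.reflLaplace a s u ∂(volume : Measure Plane)[|p.annulus] =
      ∫ u, (1 - p.reflLaplace a s u) ∂(volume : Measure Plane)[|p.annulus] := by
    rw [integral_sub (integrable_const _) hint]; simp
  rw [h1, ProbabilityTheory.cond, integral_smul_measure, ENNReal.toReal_inv, ← measureReal_def,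
    p.volume_annulus, Real.coe_toNNReal _ (by rw [mul_assoc]; exact mul_nonneg p.densRIS_pos.le hA.le),
    mul_assoc, Complex.real_smul]
  set I := ∫ u in p.annulus, (1 - p.reflLaplace a s u)
  have hA' : ((Real.pi * (p.Rout ^ 2 - p.Rin ^ 2) : ℝ) : ℂ) ≠ 0 := by exact_mod_cast hA.ne'
  rw [Complex.ofReal_mul, Complex.ofReal_inv, mul_assoc, ← mul_assoc _ _ I, mul_inv_cancel₀ hA',
    one_mul]

theorem norm_beamLaplace_le_one {s : ℂ} (hs : 0 ≤ s.re) : ‖p.beamLaplace s‖ ≤ 1 :=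
  (norm_integral_le_of_norm_le_const (C := 1) (p.ae_nonneg_beamPowerLaw.mono
      fun _ ht => norm_cexp_neg_mul_le_one hs ht)).trans (by simp)

theorem norm_one_div_one_add_le_one {z : ℂ} (hz : 0 ≤ z.re) : ‖1 / (1 + z)‖ ≤ 1 := by
  rw [norm_div, norm_one]
  refine div_le_one_of_le₀ ?_ (norm_nonneg _)
  have := Complex.re_le_norm (1 + z)
  simp at this; linarith

theorem measurable_beamLaplace : Measurable p.beamLaplace := by
  refine (StronglyMeasurable.integral_prod_right'
    (f := fun q : ℂ × ℝ => Complex.exp (-q.1 * (q.2 : ℂ)))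
    (Measurable.stronglyMeasurable ?_)).measurable
  fun_prop

theorem cellLaplace_eq (a : Plane) {s : ℂ} (hs : 0 ≤ s.re) : p.cellLaplace a s =
    1 / (1 + s * p.P₀ * p.T * p.pathLoss ‖a‖) *
    Complex.exp (-((p.beam / (2 * Real.pi) : ℝ) : ℂ) * p.densRIS *
      ∫ ψ in (0 : ℝ)..(2 * Real.pi), ∫ y in p.Rin..p.Rout,
        (y : ℂ) * (1 - p.beamLaplace (s * p.P₀ * p.T * p.reflLossPolar ‖a‖ y ψ))) *
    Complex.exp (-((1 - p.beam / (2 * Real.pi) : ℝ) : ℂ) * p.densRIS *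
      ∫ ψ in (0 : ℝ)..(2 * Real.pi), ∫ y in p.Rin..p.Rout,
        (y : ℂ) * (1 - 1 / (1 + s * ((p.M : ℂ) - p.Mo) * p.P₀ * p.T *
          p.reflLossPolar ‖a‖ y ψ))) := by
  -- The argument of the fading transforms as a function of the RIS's distance `y` to its BS and `z`
  -- to the user; its real part is nonnegative when both are.
  set W : ℝ → ℝ → ℂ := fun y z => s * p.P₀ * p.T * ((p.pathLoss z * p.pathLoss y : ℝ) : ℂ) with hW
  have hWm : Measurable (Function.uncurry W) := by
    simp only [hW, Function.uncurry_def]; fun_prop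
  have hWre : ∀ y z, 0 ≤ y → 0 ≤ z → 0 ≤ (W y z).re := by
    intro y z hy hz
    have : W y z = s * ((p.P₀ * p.T * (p.pathLoss z * p.pathLoss y) : ℝ) : ℂ) := by
      simp only [hW]; push_cast; ring
    rw [this, Complex.re_mul_ofReal]
    exact mul_nonneg hs (mul_nonneg (mul_nonneg p.P₀_pos.le p.T_pos.le)
      (mul_nonneg (p.pathLoss_nonneg hz) (p.pathLoss_nonneg hy)))
  set K₁ : ℝ → ℝ → ℂ := fun y z => 1 - p.beamLaplace (W y z) with hK₁
  set K₂ : ℝ → ℝ → ℂ := fun y z => 1 - 1 / (1 + W y z * ((p.M : ℂ) - p.Mo)) with hK₂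
  have hK₁m : Measurable (Function.uncurry K₁) :=
    measurable_const.sub (p.measurable_beamLaplace.comp hWm)
  have hK₂m : Measurable (Function.uncurry K₂) :=
    measurable_const.sub (measurable_const.div (measurable_const.add (hWm.mul_const _)))
  have two : ∀ z : ℂ, ‖z‖ ≤ 1 → ‖1 - z‖ ≤ 2 := fun z hz => by
    have := norm_sub_le 1 z
    rw [norm_one] at this; linarith
  have hK₁b : ∀ y z, 0 ≤ y → 0 ≤ z → ‖K₁ y z‖ ≤ 2 := fun y z hy hz =>
    two _ (p.norm_beamLaplace_le_one (hWre y z hy hz))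
  have hK₂b : ∀ y z, 0 ≤ y → 0 ≤ z → ‖K₂ y z‖ ≤ 2 := fun y z hy hz => by
    refine two _ (norm_one_div_one_add_le_one ?_)
    have := mul_nonneg (hWre y z hy hz) p.M_sub_Mo_nonneg
    simpa using this
  have hint : ∀ K : ℝ → ℝ → ℂ, Measurable (Function.uncurry K) →
      (∀ y z, 0 ≤ y → 0 ≤ z → ‖K y z‖ ≤ 2) →
      IntegrableOn (fun u : Plane => K ‖u‖ ‖a + u‖) p.annulus := by
    intro K hK hb
    refine Measure.integrableOn_of_bounded (M := 2) p.volume_annulus_ne_top ?_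
      (Filter.Eventually.of_forall fun u => hb _ _ (norm_nonneg _) (norm_nonneg _))
    exact (hK.comp (f := fun u : Plane => (‖u‖, ‖a + u‖)) (by fun_prop)).aestronglyMeasurable
  have hsplit : ∀ u : Plane, 1 - p.reflLaplace a s u =
      ((p.beam / (2 * Real.pi) : ℝ) : ℂ) * K₁ ‖u‖ ‖a + u‖ +
        ((1 - p.beam / (2 * Real.pi) : ℝ) : ℂ) * K₂ ‖u‖ ‖a + u‖ := by
    intro u
    have hu : s * p.P₀ * p.T * p.reflLoss a (a + u) = W ‖u‖ ‖a + u‖ := by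
      simp [hW, reflLoss]
    rw [reflLaplace, hu, p.integral_cexp_neg_mul_reflPowerLaw (hWre _ _ (norm_nonneg _)
      (norm_nonneg _)), hK₁, hK₂]
    push_cast; ring
  rw [p.cellLaplace_eq_exp a hs, mul_assoc (1 / _ : ℂ), ← Complex.exp_add]
  congr 2
  simp_rw [hsplit]
  rw [integral_add ((hint _ hK₁m hK₁b).const_mul _) ((hint _ hK₂m hK₂b).const_mul _),
    integral_const_mul, integral_const_mul, p.setIntegral_annulus hK₁m hK₁b,
    p.setIntegral_annulus hK₂m hK₂b]
  have e1 : ∀ y ψ : ℝ, K₁ y (Real.sqrt (‖a‖ ^ 2 + y ^ 2 - 2 * ‖a‖ * y * Real.cos ψ)) =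
      1 - p.beamLaplace (s * p.P₀ * p.T * p.reflLossPolar ‖a‖ y ψ) := by
    intro y ψ
    rw [hK₁, hW, reflLossPolar, mul_comm (p.pathLoss y)]
  have e2 : ∀ y ψ : ℝ, K₂ y (Real.sqrt (‖a‖ ^ 2 + y ^ 2 - 2 * ‖a‖ * y * Real.cos ψ)) =
      1 - 1 / (1 + s * ((p.M : ℂ) - p.Mo) * p.P₀ * p.T * p.reflLossPolar ‖a‖ y ψ) := by
    intro y ψ
    simp only [hK₂, hW, reflLossPolar, mul_comm (p.pathLoss y)]
    congr 3; ring
  simp_rw [e1, e2]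
  ring

/-- Rotation invariance is read off the explicit formula. It allows the point `!₂[x, 0]` to stand
for every BS at distance `x`. -/
theorem cellLaplace_congr {a b : Plane} (h : ‖a‖ = ‖b‖) {s : ℂ} (hs : 0 ≤ s.re) :
    p.cellLaplace a s = p.cellLaplace b s := by
  rw [p.cellLaplace_eq a hs, p.cellLaplace_eq b hs, h]

end NetworkParams

/-! ### Mean interference from one cell -/

theorem lintegral_natCast_poissonMeasure (r : ℝ≥0) :
    ∫⁻ n, (n : ℝ≥0∞) ∂poissonMeasure r = r := by
  have hw : ∑' n : ℕ, ENNReal.ofReal (Real.exp (-r) * r ^ n / n.factorial) = 1 := by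
    rw [← ENNReal.ofReal_tsum_of_nonneg (fun n => by positivity)
      (hasSum_one_poissonMeasure r).summable, (hasSum_one_poissonMeasure r).tsum_eq,
      ENNReal.ofReal_one]
  rw [poissonMeasure, lintegral_sum_measure]
  simp_rw [lintegral_smul_measure, lintegral_dirac]
  -- The term `n = 0` vanishes, and `(n + 1) / (n + 1)! = 1 / n!` turns the rest into `r` times the
  -- total mass.
  rw [tsum_eq_zero_add' ENNReal.summable]
  have h : ∀ n : ℕ, ENNReal.ofReal (Real.exp (-r) * r ^ (n + 1) / (n + 1).factorial) •
      ((n + 1 : ℕ) : ℝ≥0∞) =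
        (r : ℝ≥0∞) * ENNReal.ofReal (Real.exp (-r) * r ^ n / n.factorial) := by
    intro n
    rw [smul_eq_mul, ← ENNReal.ofReal_natCast, ← ENNReal.ofReal_mul (by positivity),
      ← ENNReal.ofReal_coe_nnreal, ← ENNReal.ofReal_mul (by positivity)]
    congr 1
    rw [Nat.factorial_succ]
    push_cast
    field_simp
    ring
  simp_rw [h]
  rw [ENNReal.tsum_mul_left, hw]
  simp

namespace NetworkParams

variable (p : NetworkParams)

theorem pathLoss_le {d e : ℝ} (hd : 0 ≤ d) (h : d ≤ e) : p.pathLoss e ≤ p.pathLoss d :=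
  mul_le_mul_of_nonneg_left (Real.rpow_le_rpow_of_nonpos (by linarith) (by linarith)
    (by linarith [p.two_lt_α])) p.β_pos.le

/-- The BS-RIS factor is at most `pathLoss 0 = β`. For the other factor, `‖a‖ + 1 ≤ (‖a + u‖ + 1) (1
+ Rout)`, so moving from the BS to one of its RISs costs at most `(1 + Rout) ^ α`. -/
theorem reflLoss_add_le (a : Plane) {u : Plane} (hu : ‖u‖ ≤ p.Rout) :
    p.reflLoss a (a + u) ≤ p.pathLoss ‖a‖ * ((1 + p.Rout) ^ p.α * p.β) := by
  have hR : 0 < 1 + p.Rout := by linarith [norm_nonneg u]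
  have h1 : p.pathLoss ‖a - (a + u)‖ ≤ p.β := by
    have := p.pathLoss_le le_rfl (norm_nonneg (a - (a + u)))
    simpa [pathLoss] using this
  have h2 : ‖a‖ ≤ ‖a + u‖ + p.Rout := by
    have := norm_sub_le (a + u) u
    rw [add_sub_cancel_right] at this; linarith
  have h3 : p.pathLoss ‖a + u‖ ≤ p.pathLoss ‖a‖ * (1 + p.Rout) ^ p.α := by
    have h4 : (‖a‖ + 1) / (1 + p.Rout) ≤ ‖a + u‖ + 1 := by
      rw [div_le_iff₀ hR]
      nlinarith [norm_nonneg (a + u), norm_nonneg u]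
    have h5 : (‖a + u‖ + 1) ^ (-p.α) ≤ ((‖a‖ + 1) / (1 + p.Rout)) ^ (-p.α) :=
      Real.rpow_le_rpow_of_nonpos (by positivity) h4 (by linarith [p.two_lt_α])
    rw [Real.div_rpow (by positivity) hR.le, Real.rpow_neg hR.le, div_inv_eq_mul] at h5
    rw [pathLoss, pathLoss, mul_assoc]
    exact mul_le_mul_of_nonneg_left h5 p.β_pos.le
  rw [reflLoss, ← mul_assoc]
  exact mul_le_mul h3 h1 (p.pathLoss_nonneg (norm_nonneg _))
    (mul_nonneg (p.pathLoss_nonneg (norm_nonneg _)) (Real.rpow_nonneg hR.le _))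

/-- A random variable, independent of the position of the BS, that dominates the interference from
one cell up to the path loss of its BS. -/
noncomputable def cellDominant (m : CellMark) : ℝ≥0∞ :=
  ENNReal.ofReal p.P₀ * (‖m.2.2.1‖ₑ + ENNReal.ofReal ((1 + p.Rout) ^ p.α * p.β) *
    ∑ j ∈ Finset.range m.1, ‖m.2.2.2 j‖ₑ)

theorem measurable_cellDominant : Measurable p.cellDominant := by
  refine measurable_from_prod_countable_right fun n => ?_
  simp only [cellDominant]
  fun_prop

theorem ae_cellPower_le : ∀ᵐ m ∂p.cellMarkLaw, ∀ a,
    ENNReal.ofReal (p.cellPower a m) ≤ ENNReal.ofReal (p.pathLoss ‖a‖) * p.cellDominant m := by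
  have h1 : ∀ᵐ m ∂p.cellMarkLaw, 0 ≤ m.2.2.1 :=
    Measure.quasiMeasurePreserving_snd.ae (Measure.quasiMeasurePreserving_snd.ae
      (Measure.quasiMeasurePreserving_fst.ae ae_nonneg_expMeasure))
  have h2 : ∀ᵐ m ∂p.cellMarkLaw, ∀ j, 0 ≤ m.2.2.2 j :=
    Measure.quasiMeasurePreserving_snd.ae (Measure.quasiMeasurePreserving_snd.ae
      (Measure.quasiMeasurePreserving_snd.ae
        (ae_all_iff.2 fun j => (measurePreserving_eval_infinitePi _ j).quasiMeasurePreserving.ae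
          p.ae_nonneg_reflPowerLaw)))
  have h3 : ∀ᵐ m ∂p.cellMarkLaw, ∀ j, m.2.1 j ∈ p.annulus :=
    Measure.quasiMeasurePreserving_snd.ae (Measure.quasiMeasurePreserving_fst.ae
      (ae_all_iff.2 fun j => (measurePreserving_eval_infinitePi _ j).quasiMeasurePreserving.ae
          (ae_cond_mem p.measurableSet_annulus)))
  filter_upwards [h1, h2, h3] with m hm1 hm2 hm3 a
  have hP := p.P₀_pos.le
  have hg := p.pathLoss_nonneg (norm_nonneg a)
  have hc : 0 ≤ (1 + p.Rout) ^ p.α * p.β :=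
    mul_nonneg (Real.rpow_nonneg (by linarith [p.Rin_nonneg, p.Rin_lt_Rout]) _) p.β_pos.le
  have hb : p.cellPower a m ≤ p.pathLoss ‖a‖ * (p.P₀ * (m.2.2.1 +
      (1 + p.Rout) ^ p.α * p.β * ∑ j ∈ Finset.range m.1, m.2.2.2 j)) := by
    have : ∑ j ∈ Finset.range m.1, m.2.2.2 j * p.P₀ * p.reflLoss a (a + m.2.1 j) ≤
        ∑ j ∈ Finset.range m.1, m.2.2.2 j * p.P₀ *
          (p.pathLoss ‖a‖ * ((1 + p.Rout) ^ p.α * p.β)) :=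
      Finset.sum_le_sum fun j _ => mul_le_mul_of_nonneg_left
        (p.reflLoss_add_le a (hm3 j).2) (mul_nonneg (hm2 j) hP)
    rw [← Finset.sum_mul, ← Finset.sum_mul] at this
    calc p.cellPower a m = m.2.2.1 * p.P₀ * p.pathLoss ‖a‖ +
          ∑ j ∈ Finset.range m.1, m.2.2.2 j * p.P₀ * p.reflLoss a (a + m.2.1 j) := rfl
      _ ≤ _ := by linarith
  refine (ENNReal.ofReal_le_ofReal hb).trans (le_of_eq ?_)
  rw [ENNReal.ofReal_mul hg, ENNReal.ofReal_mul hP, cellDominant,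
    ENNReal.ofReal_add hm1 (mul_nonneg hc (Finset.sum_nonneg fun j _ => hm2 j)),
    ENNReal.ofReal_mul hc, ENNReal.ofReal_sum_of_nonneg fun j _ => hm2 j]
  simp_rw [Real.enorm_of_nonneg hm1, fun j => Real.enorm_of_nonneg (hm2 j)]

theorem lintegral_cellDominant_ne_top : ∫⁻ m, p.cellDominant m ∂p.cellMarkLaw ≠ ∞ := by
  have hD : ∫⁻ t, ‖t‖ₑ ∂expMeasure 1 ≠ ∞ := integrable_id_expMeasure.2.ne
  have hR : ∫⁻ t, ‖t‖ₑ ∂p.reflPowerLaw ≠ ∞ := p.integrable_id_reflPowerLaw.2.ne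
  rw [cellMarkLaw, lintegral_prod _ p.measurable_cellDominant.aemeasurable]
  have h : ∀ n : ℕ, ∫⁻ m, p.cellDominant (n, m) ∂p.restLaw =
      ENNReal.ofReal p.P₀ * ((∫⁻ t, ‖t‖ₑ ∂expMeasure 1) +
        ENNReal.ofReal ((1 + p.Rout) ^ p.α * p.β) * (n * ∫⁻ t, ‖t‖ₑ ∂p.reflPowerLaw)) := by
    intro n
    simp only [cellDominant]
    rw [lintegral_const_mul _ (by fun_prop), lintegral_add_left (by fun_prop),
      lintegral_const_mul _ (by fun_prop), lintegral_finsetSum _ (fun j _ => by fun_prop)]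
    have e1 : ∫⁻ m, ‖m.2.1‖ₑ ∂p.restLaw = ∫⁻ t, ‖t‖ₑ ∂expMeasure 1 :=
      (measurePreserving_fst.comp measurePreserving_snd).lintegral_comp
        (f := fun t : ℝ => ‖t‖ₑ) (by fun_prop)
    have e2 : ∀ j, ∫⁻ m, ‖m.2.2 j‖ₑ ∂p.restLaw = ∫⁻ t, ‖t‖ₑ ∂p.reflPowerLaw := fun j =>
      ((measurePreserving_eval_infinitePi (fun _ : ℕ => p.reflPowerLaw) j).comp
        (measurePreserving_snd.comp measurePreserving_snd)).lintegral_comp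
          (f := fun t : ℝ => ‖t‖ₑ) (by fun_prop)
    simp [e1, e2]
  simp_rw [h]
  rw [lintegral_const_mul _ (by fun_prop), lintegral_add_left (by fun_prop),
      lintegral_const_mul _ (by fun_prop), lintegral_mul_const _ (by fun_prop),
      lintegral_natCast_poissonMeasure]
  simp only [lintegral_const, measure_univ, mul_one]
  finiteness

/-! ### Decay of `1 - cellLaplace` with the distance, and its radial integral. -/

theorem measurable_cellLaplace (s : ℂ) : Measurable (fun a => p.cellLaplace a s) := by
  refine (StronglyMeasurable.integral_prod_right'
    (f := fun q : Plane × CellMark => Complex.exp (-s * ((p.T * p.cellPower q.1 q.2 : ℝ) : ℂ)))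
    (Measurable.stronglyMeasurable ?_)).measurable
  have := p.measurable_cellPower
  fun_prop

/-- Mean value inequality on the closed right half-plane, which is convex and where the derivative
of `exp (-w)` has norm at most one. -/
theorem norm_one_sub_cexp_neg_le {z : ℂ} (hz : 0 ≤ z.re) : ‖1 - Complex.exp (-z)‖ ≤ ‖z‖ := by
  have h := (convex_halfSpace_re_ge 0).norm_image_sub_le_of_norm_hasDerivWithin_le
    (f := fun w : ℂ => Complex.exp (-w)) (f' := fun w => Complex.exp (-w) * (-1)) (C := 1)
    (x := z) (y := 0)
    (fun w _ => ((hasDerivAt_id w).neg.cexp).hasDerivWithinAt)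
    (fun w hw => by
      rw [mul_neg_one, norm_neg, Complex.norm_exp]
      simpa using hw) hz (by simp)
  simpa using h

/-- The transform approaches one at the rate of the path loss, with the mean of `cellDominant` as
constant. This makes the exponent of the main formula absolutely convergent. -/
theorem norm_one_sub_cellLaplace_le (a : Plane) {s : ℂ} (hs : 0 ≤ s.re) :
    ‖1 - p.cellLaplace a s‖ ≤ ‖s‖ * p.T * p.pathLoss ‖a‖ *
      (∫⁻ m, p.cellDominant m ∂p.cellMarkLaw).toReal := by
  have hcp : Measurable (fun m => p.cellPower a m) :=
      p.measurable_cellPower.comp (f := fun m => (a, m)) (by fun_prop)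
  have hint : Integrable (fun m => Complex.exp (-s * ((p.T * p.cellPower a m : ℝ) : ℂ)))
      p.cellMarkLaw :=
    Integrable.of_bound (Measurable.aestronglyMeasurable (by fun_prop)) 1
    (p.ae_cellPower_nonneg.mono fun m hm => p.norm_cexp_neg_mul_T_le_one hs (hm a))
  have h1 : 1 - p.cellLaplace a s =
      ∫ m, (1 - Complex.exp (-s * ((p.T * p.cellPower a m : ℝ) : ℂ))) ∂p.cellMarkLaw := by
    rw [integral_sub (integrable_const _) hint]; simp [cellLaplace]
  have hD : Integrable (fun m => (p.cellDominant m).toReal) p.cellMarkLaw :=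
    integrable_toReal_of_lintegral_ne_top p.measurable_cellDominant.aemeasurable
      p.lintegral_cellDominant_ne_top
  have hfin : ∀ m, p.cellDominant m ≠ ∞ := fun m => by
    have hsum : ∑ j ∈ Finset.range m.1, ‖m.2.2.2 j‖ₑ ≠ ∞ := ENNReal.sum_ne_top.2 fun j _ =>
      enorm_ne_top
    exact ENNReal.mul_ne_top ENNReal.ofReal_ne_top (ENNReal.add_ne_top.2 ⟨enorm_ne_top,
      ENNReal.mul_ne_top ENNReal.ofReal_ne_top hsum⟩)
  rw [h1, ← integral_toReal p.measurable_cellDominant.aemeasurable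
    (Filter.Eventually.of_forall fun m => (hfin m).lt_top), ← integral_const_mul]
  refine norm_integral_le_of_norm_le (hD.const_mul _) ?_
  filter_upwards [p.ae_cellPower_nonneg, p.ae_cellPower_le] with m hm1 hm2
  have h2 : p.cellPower a m ≤ p.pathLoss ‖a‖ * (p.cellDominant m).toReal := by
    have := ENNReal.toReal_mono (by finiteness [hfin m]) (hm2 a)
    rwa [ENNReal.toReal_ofReal (hm1 a), ENNReal.toReal_mul,
      ENNReal.toReal_ofReal (p.pathLoss_nonneg (norm_nonneg _))] at this
  have hre : 0 ≤ (s * ((p.T * p.cellPower a m : ℝ) : ℂ)).re := by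
    rw [Complex.re_mul_ofReal]; exact mul_nonneg hs (mul_nonneg p.T_pos.le (hm1 a))
  rw [neg_mul]
  refine (norm_one_sub_cexp_neg_le hre).trans ?_
  rw [norm_mul, Complex.norm_real, Real.norm_of_nonneg (mul_nonneg p.T_pos.le (hm1 a)), mul_assoc,
    mul_assoc]
  exact mul_le_mul_of_nonneg_left (mul_le_mul_of_nonneg_left h2 p.T_pos.le) (norm_nonneg _)

/-- Here `α` is compared with the dimension of the plane. -/
theorem integrable_pathLoss : Integrable (fun a : Plane => p.pathLoss ‖a‖) := by
  have := (integrable_one_add_norm (E := Plane) (μ := volume) (r := p.α)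
    (by simpa using p.two_lt_α)).const_mul p.β
  refine this.congr (Filter.Eventually.of_forall fun a => ?_)
  simp only [pathLoss, add_comm]

theorem integrable_one_sub_cellLaplace {s : ℂ} (hs : 0 ≤ s.re) :
    Integrable (fun a : Plane => 1 - p.cellLaplace a s) := by
  refine ((p.integrable_pathLoss.const_mul (‖s‖ * p.T)).mul_const _).mono'
    (measurable_const.sub (p.measurable_cellLaplace s)).aestronglyMeasurable
    (Filter.Eventually.of_forall fun a => p.norm_one_sub_cellLaplace_le a hs)

theorem norm_vec_zero {x : ℝ} (hx : 0 ≤ x) : ‖(!₂[x, 0] : Plane)‖ = x := by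
  simp [EuclideanSpace.norm_eq, Real.sqrt_sq hx]

theorem cellLaplace_norm (a : Plane) {s : ℂ} (hs : 0 ≤ s.re) :
    p.cellLaplace !₂[‖a‖, 0] s = p.cellLaplace a s :=
  p.cellLaplace_congr (norm_vec_zero (norm_nonneg a)) hs

theorem integrableOn_radial {s : ℂ} (hs : 0 ≤ s.re) {r : ℝ} (hr : 0 ≤ r) :
    IntegrableOn (fun x : ℝ => (x : ℂ) * (1 - p.cellLaplace !₂[x, 0] s)) (Ioi r) := by
  have h := (integrable_fun_norm_addHaar (volume : Measure Plane)
    (f := fun x : ℝ => 1 - p.cellLaplace !₂[x, 0] s)).1 (by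
      simpa only [p.cellLaplace_norm _ hs] using p.integrable_one_sub_cellLaplace hs)
  refine (h.congr_fun (fun x _ => ?_) measurableSet_Ioi).mono_set (Ioi_subset_Ioi hr)
  simp

theorem setIntegral_norm_gt {s : ℂ} (hs : 0 ≤ s.re) {r : ℝ} (hr : 0 ≤ r) :
    ∫ a in {a : Plane | r < ‖a‖}, (1 - p.cellLaplace a s) =
      2 * Real.pi * ∫ x in Ioi r, (x : ℂ) * (1 - p.cellLaplace !₂[x, 0] s) := by
  have h := integral_fun_norm_addHaar (volume : Measure Plane)
    ((Ioi r).indicator fun x : ℝ => 1 - p.cellLaplace !₂[x, 0] s)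
  have hv : (volume : Measure Plane).real (Metric.ball 0 1) = Real.pi := by
    simp [measureReal_def, EuclideanSpace.volume_ball_fin_two, Real.pi_pos.le]
  have hms : MeasurableSet {a : Plane | r < ‖a‖} := measurableSet_lt measurable_const measurable_norm
  have e1 : ∫ a : Plane, (Ioi r).indicator (fun x : ℝ => 1 - p.cellLaplace !₂[x, 0] s) ‖a‖ =
      ∫ a in {a : Plane | r < ‖a‖}, (1 - p.cellLaplace a s) := by
    rw [← integral_indicator hms]
    congr with a
    simp only [indicator, mem_Ioi, mem_ofPred_eq, p.cellLaplace_norm _ hs]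
  have e2 : ∫ y in Ioi (0 : ℝ), y ^ (Module.finrank ℝ Plane - 1) •
      (Ioi r).indicator (fun x : ℝ => 1 - p.cellLaplace !₂[x, 0] s) y =
      ∫ x in Ioi r, (x : ℂ) * (1 - p.cellLaplace !₂[x, 0] s) := by
    have h' := setIntegral_indicator (μ := volume) (s := Ioi 0) (t := Ioi r) measurableSet_Ioi
      (f := fun x : ℝ => (x : ℂ) * (1 - p.cellLaplace !₂[x, 0] s))
    rw [inter_eq_right.2 (Ioi_subset_Ioi hr)] at h'
    rw [← h']
    congr with x
    simp [indicator]
  rw [← e1, h, hv, e2]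
  simp [mul_assoc]

end NetworkParams

/-! ### Products over point processes -/

/-- Test functions equal to one off a set of finite intensity leave almost surely finitely many
nontrivial factors. Measurability and limits of such products are obtained from the partial
products. -/
theorem tendsto_prod_range_finprod {f : ℕ → ℂ} (hf : f.mulSupport.Finite) :
    Filter.Tendsto (fun n => ∏ i ∈ Finset.range n, f i) Filter.atTop (nhds (∏ᶠ i, f i)) := by
  obtain ⟨N, hN⟩ := hf.bddAbove
  refine tendsto_const_nhds.congr' ?_
  filter_upwards [Filter.eventually_gt_atTop N] with n hn
  exact finprod_eq_prod_of_mulSupport_subset _ fun i hi => by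
    simpa using (hN hi).trans_lt hn

theorem norm_finprod_le_one {f : ℕ → ℂ} (hf : ∀ i, ‖f i‖ ≤ 1) : ‖∏ᶠ i, f i‖ ≤ 1 :=
  finprod_induction (p := fun z : ℂ => ‖z‖ ≤ 1) (by simp)
    (fun x y hx hy => by
      rw [norm_mul]; exact mul_le_one₀ hx (norm_nonneg _) hy) hf

theorem norm_prod_range_le_one {f : ℕ → ℂ} (hf : ∀ i, ‖f i‖ ≤ 1) (n : ℕ) :
    ‖∏ i ∈ Finset.range n, f i‖ ≤ 1 := by
  rw [norm_prod]
  exact Finset.prod_le_one (fun i _ => norm_nonneg _) fun i _ => hf i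

section PointCount

variable {Ω : Type*} {x : ℕ → Ω → Plane}

/-- Writing the count as a sum of indicators gives both its measurability and Campbell's formula. -/
theorem toENNReal_pointCount (A : Set Plane) (ω : Ω) :
    (pointCount x A ω : ℝ≥0∞) = ∑' i, (x i ⁻¹' A).indicator 1 ω := by
  rw [pointCount, ← ENNReal.tsum_set_one, tsum_subtype _ (fun _ => (1 : ℝ≥0∞))]
  rfl

theorem finite_of_pointCount_ne_top {A : Set Plane} {ω : Ω} (h : pointCount x A ω ≠ ⊤) :
    {i | x i ω ∈ A}.Finite := by
  rwa [pointCount, Set.encard_ne_top_iff] at h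

variable [MeasurableSpace Ω]

theorem measurable_toENNReal_pointCount (hx : ∀ i, Measurable (x i)) {A : Set Plane}
    (hA : MeasurableSet A) : Measurable fun ω => (pointCount x A ω : ℝ≥0∞) := by
  simp_rw [toENNReal_pointCount]
  exact Measurable.tsum fun i => measurable_one.indicator (hx i hA)

end PointCount

namespace IsPoissonProcess

variable {Ω : Type*} [MeasurableSpace Ω] {μ : Measure Ω} {x : ℕ → Ω → Plane} {Λ : Measure Plane}

theorem lintegral_pointCount (h : IsPoissonProcess x Λ μ) {A : Set Plane} (hA : MeasurableSet A)
    (hΛ : Λ A ≠ ∞) : ∫⁻ ω, (pointCount x A ω : ℝ≥0∞) ∂μ = Λ A := by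
  rw [(h.hasLaw_count A hA hΛ).lintegral_comp (f := fun n : ℕ∞ => (n : ℝ≥0∞))
    Measurable.of_discrete.aemeasurable, lintegral_map Measurable.of_discrete Measurable.of_discrete]
  simp only [ENat.toENNReal_coe]
  rw [lintegral_natCast_poissonMeasure]
  simp [hΛ]

theorem ae_pointCount_ne_top (h : IsPoissonProcess x Λ μ) {A : Set Plane} (hA : MeasurableSet A)
    (hΛ : Λ A ≠ ∞) : ∀ᵐ ω ∂μ, pointCount x A ω ≠ ⊤ := by
  have := ae_lt_top (measurable_toENNReal_pointCount h.measurable hA)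
    (by rwa [h.lintegral_pointCount hA hΛ])
  filter_upwards [this] with ω hω hω'
  simp [hω'] at hω

theorem ae_finite (h : IsPoissonProcess x Λ μ) {A : Set Plane} (hA : MeasurableSet A)
    (hΛ : Λ A ≠ ∞) : ∀ᵐ ω ∂μ, {i | x i ω ∈ A}.Finite :=
  (h.ae_pointCount_ne_top hA hΛ).mono fun _ => finite_of_pointCount_ne_top

/-- Campbell's formula: the sum of the laws of the points is the intensity measure. -/
theorem sum_map_eq [SigmaFinite Λ] (h : IsPoissonProcess x Λ μ) :
    Measure.sum (fun i => μ.map (x i)) = Λ := by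
  have hfin : ∀ A, MeasurableSet A → Λ A ≠ ∞ → Measure.sum (fun i => μ.map (x i)) A = Λ A := by
    intro A hA hΛ
    rw [Measure.sum_apply _ hA, ← h.lintegral_pointCount hA hΛ]
    simp_rw [toENNReal_pointCount]
    rw [lintegral_tsum fun i => (measurable_one.indicator (h.measurable i hA)).aemeasurable]
    congr with i
    rw [Measure.map_apply (h.measurable i) hA, lintegral_indicator_one (h.measurable i hA)]
  refine Measure.ext fun A hA => ?_
  have hU : A = ⋃ n, A ∩ spanningSets Λ n := by
    rw [← inter_iUnion, iUnion_spanningSets, inter_univ]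
  have hmono : Monotone fun n => A ∩ spanningSets Λ n := fun m n hmn =>
    inter_subset_inter_right _ (monotone_spanningSets Λ hmn)
  rw [hU, hmono.measure_iUnion, hmono.measure_iUnion]
  congr with n
  exact hfin _ (hA.inter (measurableSet_spanningSets Λ n))
    ((measure_mono inter_subset_right).trans_lt (measure_spanningSets_lt_top Λ n)).ne

/-- `toNat` sends an infinite count to `0`, which is harmless because the count is almost surely
finite. -/
theorem integral_pow_pointCount (h : IsPoissonProcess x Λ μ) {A : Set Plane}
    (hA : MeasurableSet A) (hΛ : Λ A ≠ ∞) (z : ℂ) :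
    ∫ ω, z ^ (pointCount x A ω).toNat ∂μ = Complex.exp (-(Λ.real A * (1 - z))) := by
  have := (h.hasLaw_count A hA hΛ).integral_comp (f := fun n : ℕ∞ => z ^ n.toNat)
    Measurable.of_discrete.aestronglyMeasurable
  simp only [Function.comp_def] at this
  rw [this, integral_map Measurable.of_discrete.aemeasurable
    Measurable.of_discrete.aestronglyMeasurable]
  simp only [ENat.toNat_natCast]
  rw [integral_pow_poissonMeasure]
  rfl

theorem ae_finite_mulSupport (h : IsPoissonProcess x Λ μ) {A : Set Plane} (hA : MeasurableSet A)
    (hΛ : Λ A ≠ ∞) {M : Type*} {m : ℕ → Ω → M} {g : Plane → M → ℂ}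
    (hg : ∀ y ∉ A, ∀ z, g y z = 1) :
    ∀ᵐ ω ∂μ, (Function.mulSupport fun i => g (x i ω) (m i ω)).Finite := by
  filter_upwards [h.ae_finite hA hΛ] with ω hω
  refine hω.subset fun i hi => ?_
  by_contra hi'
  exact hi (hg _ hi' _)

theorem aestronglyMeasurable_finprod (h : IsPoissonProcess x Λ μ) {A : Set Plane}
    (hA : MeasurableSet A) (hΛ : Λ A ≠ ∞) {M : Type*} [MeasurableSpace M] {m : ℕ → Ω → M}
    (hm : ∀ i, Measurable (m i)) {g : Plane → M → ℂ} (hgm : Measurable (Function.uncurry g))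
    (hg : ∀ y ∉ A, ∀ z, g y z = 1) :
    AEStronglyMeasurable (fun ω => ∏ᶠ i, g (x i ω) (m i ω)) μ := by
  refine aestronglyMeasurable_of_tendsto_ae Filter.atTop
    (f := fun n ω => ∏ i ∈ Finset.range n, g (x i ω) (m i ω)) (fun n => ?_)
    ((h.ae_finite_mulSupport hA hΛ hg).mono fun ω hω => tendsto_prod_range_finprod hω)
  exact (Finset.measurable_prod _ fun i _ =>
    hgm.comp ((h.measurable i).prodMk (hm i))).aestronglyMeasurable

/-- Grouping the points by the value of `f` turns the product into powers of the counts on the level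
sets in `A`. These counts are independent and Poisson, so the expectation is a product of Poisson
generating functions. -/
theorem integral_finprod_simpleFunc (h : IsPoissonProcess x Λ μ) {A : Set Plane}
    (hA : MeasurableSet A) (hΛ : Λ A ≠ ∞) (f : SimpleFunc Plane ℂ) :
    ∫ ω, ∏ᶠ i, A.mulIndicator f (x i ω) ∂μ = Complex.exp (-∫ y in A, (1 - f y) ∂Λ) := by
  classical
  set B : f.range → Set Plane := fun v => A ∩ f ⁻¹' {(v : ℂ)} with hB
  have hBm : ∀ v, MeasurableSet (B v) := fun v => hA.inter (f.measurableSet_preimage _)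
  have hBΛ : ∀ v, Λ (B v) ≠ ∞ := fun v => ((measure_mono inter_subset_left).trans_lt hΛ.lt_top).ne
  have hBd : Pairwise fun v w => Disjoint (B v) (B w) := by
    intro v w hvw
    refine Disjoint.mono inter_subset_right inter_subset_right ?_
    refine Disjoint.preimage _ (disjoint_singleton.2 fun h' => hvw (Subtype.ext h'))
  have hind : iIndepFun (fun v => pointCount x (B v)) μ := by
    set e := Fintype.equivFin f.range
    have := (h.indep_count _ (fun l => B (e.symm l)) (fun l => hBm _)
      (fun l l' hl => hBd fun h' => hl (e.symm.injective h'))).precomp e.injective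
    simpa using this
  have hprod : ∀ᵐ ω ∂μ, ∏ᶠ i, A.mulIndicator f (x i ω) =
      ∏ v : f.range, (v : ℂ) ^ (pointCount x (B v) ω).toNat := by
    filter_upwards [h.ae_finite hA hΛ] with ω hω
    rw [finprod_eq_prod_of_mulSupport_subset (s := hω.toFinset)]
    · have h1 : ∏ i ∈ hω.toFinset, A.mulIndicator f (x i ω) = ∏ i ∈ hω.toFinset, f (x i ω) :=
        Finset.prod_congr rfl fun i hi => mulIndicator_of_mem (by simpa using hi) _
      rw [h1, ← Finset.prod_fiberwise_of_maps_to (t := f.range) (g := fun i => f (x i ω))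
        (fun i _ => SimpleFunc.mem_range_self f _), ← Finset.prod_coe_sort]
      refine Finset.prod_congr rfl fun v _ => ?_
      rw [Finset.prod_congr rfl (g := fun _ => (v : ℂ)) (fun i hi => (Finset.mem_filter.1 hi).2),
        Finset.prod_const]
      congr 1
      have : {i | x i ω ∈ B v} = ((hω.toFinset.filter fun i => f (x i ω) = v : Finset ℕ) : Set ℕ) := by
        ext i; simp [hB]
      rw [pointCount, this, Set.encard_coe_eq_coe_finsetCard, ENat.toNat_natCast]
    · intro i hi
      rw [Finite.coe_toFinset]
      by_contra hi'
      exact hi (mulIndicator_of_notMem (s := A) hi' f)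
  rw [integral_congr_ae hprod]
  have hmeas : ∀ v : f.range, AEStronglyMeasurable
      (fun ω => (v : ℂ) ^ (pointCount x (B v) ω).toNat) μ := fun v =>
    ((Measurable.of_discrete (f := fun n : ℕ∞ => (v : ℂ) ^ n.toNat)).comp_aemeasurable
      (h.hasLaw_count _ (hBm v) (hBΛ v)).aemeasurable).aestronglyMeasurable
  have hmul := (hind.comp (fun v n => (v : ℂ) ^ n.toNat)
    (fun v => Measurable.of_discrete)).integral_fun_prod_eq_prod_integral hmeas
  simp only [Function.comp_apply] at hmul
  rw [hmul]
  simp_rw [h.integral_pow_pointCount (hBm _) (hBΛ _)]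
  rw [← Complex.exp_sum, Finset.sum_neg_distrib]
  congr 2
  have : IsFiniteMeasure (Λ.restrict A) := ⟨by simpa using hΛ.lt_top⟩
  have hfi : Integrable f (Λ.restrict A) := f.integrable_of_isFiniteMeasure
  have hsum : ∀ v : ℂ, Λ.real (A ∩ f ⁻¹' {v}) = (Λ.restrict A).real (f ⁻¹' {v}) := fun v => by
    rw [measureReal_restrict_apply (f.measurableSet_preimage _), inter_comm]
  -- The masses of the level sets add up to that of `A`, so the exponents sum to the integral of `1
  -- - f`.
  have htot : ∑ v ∈ f.range, (Λ.restrict A).real (f ⁻¹' {v}) = (Λ.restrict A).real univ := by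
    simp only [measureReal_def]
    rw [← f.sum_range_measure_preimage_singleton (Λ.restrict A), ENNReal.toReal_sum]
    exact fun _ _ => measure_ne_top _ _
  rw [integral_sub (integrable_const _) hfi, ← SimpleFunc.integral_eq_integral _ hfi,
    SimpleFunc.integral_eq, Finset.sum_coe_sort f.range
      (fun v => ((Λ.real (A ∩ f ⁻¹' {v}) : ℝ) : ℂ) * (1 - v)), integral_const, ← htot]
  simp only [hsum, Complex.real_smul, mul_sub, mul_one, Finset.sum_sub_distrib]
  push_cast
  rfl

variable [IsProbabilityMeasure μ]

/-- The generating functional of a Poisson process. -/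
theorem integral_finprod (h : IsPoissonProcess x Λ μ) {A : Set Plane} (hA : MeasurableSet A)
    (hΛ : Λ A ≠ ∞) {f : Plane → ℂ} (hfm : Measurable f) (hf : ∀ y, ‖f y‖ ≤ 1)
    (hfA : ∀ y ∉ A, f y = 1) :
    ∫ ω, ∏ᶠ i, f (x i ω) ∂μ = Complex.exp (-∫ y in A, (1 - f y) ∂Λ) := by
  have : IsFiniteMeasure (Λ.restrict A) := ⟨by simpa using hΛ.lt_top⟩
  have h0 : (0 : ℂ) ∈ Metric.closedBall (0 : ℂ) 1 := by simp
  -- The approximants take values in the closed unit ball, so all products are bounded by one.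
  -- Outside `A` they need not equal one, hence the `mulIndicator` below.
  set F : ℕ → SimpleFunc Plane ℂ := SimpleFunc.approxOn f hfm (Metric.closedBall 0 1) 0 h0
  have hF1 : ∀ n y, ‖F n y‖ ≤ 1 := fun n y => by
    simpa using SimpleFunc.approxOn_mem hfm h0 n y
  have hFt : ∀ y, Filter.Tendsto (fun n => F n y) Filter.atTop (nhds (f y)) := fun y =>
    SimpleFunc.tendsto_approxOn hfm h0 (subset_closure (by simpa using hf y))
  have hFA1 : ∀ n y, ‖A.mulIndicator (F n) y‖ ≤ 1 := fun n y => by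
    by_cases hy : y ∈ A
    · rw [mulIndicator_of_mem hy]; exact hF1 n y
    · rw [mulIndicator_of_notMem hy]; simp
  have hFAt : ∀ y, Filter.Tendsto (fun n => A.mulIndicator (F n) y) Filter.atTop (nhds (f y)) := by
    intro y
    by_cases hy : y ∈ A
    · simp only [mulIndicator_of_mem hy]; exact hFt y
    · simp only [mulIndicator_of_notMem hy, hfA y hy]; exact tendsto_const_nhds
  have hl : Filter.Tendsto (fun n => ∫ ω, ∏ᶠ i, A.mulIndicator (F n) (x i ω) ∂μ) Filter.atTop
      (nhds (∫ ω, ∏ᶠ i, f (x i ω) ∂μ)) := by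
    refine tendsto_integral_of_dominated_convergence (fun _ => 1) (fun n => ?_)
      (integrable_const _) (fun n => Filter.Eventually.of_forall fun ω =>
        norm_finprod_le_one fun i => hFA1 n _) ?_
    · have hFAm : Measurable (A.mulIndicator (F n)) := by
        classical
        rw [← piecewise_eq_mulIndicator]
        exact (F n).measurable.piecewise hA measurable_one
      exact h.aestronglyMeasurable_finprod hA hΛ (M := Unit) (m := fun _ _ => ())
        (fun _ => measurable_const) (g := fun y _ => A.mulIndicator (F n) y)
        (hFAm.comp measurable_fst)
        (fun y hy _ => mulIndicator_of_notMem hy _)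
    · filter_upwards [h.ae_finite hA hΛ] with ω hω
      have hs : ∀ g : Plane → ℂ, (∀ y ∉ A, g y = 1) →
          ∏ᶠ i, g (x i ω) = ∏ i ∈ hω.toFinset, g (x i ω) := by
        intro g hg
        refine finprod_eq_prod_of_mulSupport_subset _ fun i hi => ?_
        rw [Finite.coe_toFinset]
        by_contra hi'
        exact hi (hg _ hi')
      rw [hs f hfA]
      simp_rw [fun n => hs (A.mulIndicator (F n)) fun y hy => mulIndicator_of_notMem hy _]
      exact tendsto_finsetProd _ fun i _ => hFAt _
  have hr : Filter.Tendsto (fun n => Complex.exp (-∫ y in A, (1 - F n y) ∂Λ)) Filter.atTop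
      (nhds (Complex.exp (-∫ y in A, (1 - f y) ∂Λ))) := by
    refine (Complex.continuous_exp.tendsto _).comp (Filter.Tendsto.neg ?_)
    refine tendsto_integral_of_dominated_convergence (fun _ => 2)
      (fun n => (measurable_const.sub (F n).measurable).aestronglyMeasurable)
      (integrable_const _) (fun n => Filter.Eventually.of_forall fun y => ?_)
      (Filter.Eventually.of_forall fun y => (hFt y).const_sub 1)
    have := norm_sub_le 1 (F n y)
    rw [norm_one] at this
    linarith [hF1 n y]
  simp_rw [h.integral_finprod_simpleFunc hA hΛ] at hl
  exact tendsto_nhds_unique hl hr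

/-- The generating functional of a Poisson process with independent marks. -/
theorem integral_finprod_mark (h : IsPoissonProcess x Λ μ) {A : Set Plane} (hA : MeasurableSet A)
    (hΛ : Λ A ≠ ∞) {M : Type*} [MeasurableSpace M] {m : ℕ → Ω → M} {ν : Measure M}
    [IsProbabilityMeasure ν] (hm : ∀ i, Measurable (m i)) (hlaw : ∀ i, HasLaw (m i) ν μ)
    (hind : iIndepFun m μ) (hxm : IndepFun (fun ω i => x i ω) (fun ω i => m i ω) μ)
    {g : Plane → M → ℂ} (hgm : Measurable (Function.uncurry g)) (hg : ∀ y z, ‖g y z‖ ≤ 1)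
    (hgA : ∀ y ∉ A, ∀ z, g y z = 1) :
    ∫ ω, ∏ᶠ i, g (x i ω) (m i ω) ∂μ = Complex.exp (-∫ y in A, (1 - ∫ z, g y z ∂ν) ∂Λ) := by
  set f : Plane → ℂ := fun y => ∫ z, g y z ∂ν with hf
  have hfm : Measurable f :=
    (StronglyMeasurable.integral_prod_right' hgm.stronglyMeasurable).measurable
  have hf1 : ∀ y, ‖f y‖ ≤ 1 := fun y =>
    (norm_integral_le_of_norm_le_const (Filter.Eventually.of_forall (hg y))).trans (by simp)
  have hfA : ∀ y ∉ A, f y = 1 := fun y hy => by simp [hf, hgA y hy]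
  have hxmeas : Measurable fun ω i => x i ω := measurable_pi_lambda _ h.measurable
  have hmmeas : Measurable fun ω i => m i ω := measurable_pi_lambda _ hm
  have hmap := (indepFun_iff_map_prod_eq_prod_map_map hxmeas.aemeasurable
    hmmeas.aemeasurable).1 hxm
  rw [(hind.hasLaw_infinitePi hlaw hmmeas.aemeasurable).map_eq] at hmap
  have : IsProbabilityMeasure (μ.map fun ω i => x i ω) :=
    Measure.isProbabilityMeasure_map hxmeas.aemeasurable
  -- For finitely many indices, independence allows the marks to be integrated out at fixed
  -- positions. Each factor `g` becomes its mean `f`, and only the unmarked functional remains after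
  -- `n → ∞`.
  have hfinite : ∀ n, ∫ ω, ∏ i ∈ Finset.range n, g (x i ω) (m i ω) ∂μ =
      ∫ ω, ∏ i ∈ Finset.range n, f (x i ω) ∂μ := by
    intro n
    have hGm : Measurable fun q : (ℕ → Plane) × (ℕ → M) =>
        ∏ i ∈ Finset.range n, g (q.1 i) (q.2 i) :=
      Finset.measurable_prod _ fun i _ => hgm.comp
        (f := fun q : (ℕ → Plane) × (ℕ → M) => (q.1 i, q.2 i)) (by fun_prop)
    have hFm : Measurable fun q : ℕ → Plane => ∏ i ∈ Finset.range n, f (q i) :=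
      Finset.measurable_prod _ fun i _ => hfm.comp (measurable_pi_apply i)
    rw [← integral_map (φ := fun ω => ((fun i => x i ω), (fun i => m i ω)))
      (hxmeas.prodMk hmmeas).aemeasurable
      (f := fun q : (ℕ → Plane) × (ℕ → M) => ∏ i ∈ Finset.range n, g (q.1 i) (q.2 i))
      hGm.aestronglyMeasurable, hmap,
      integral_prod _ (Integrable.of_bound hGm.aestronglyMeasurable 1
        (Filter.Eventually.of_forall fun q => norm_prod_range_le_one (fun i => hg _ _) n)),
      ← integral_map (φ := fun ω i => x i ω) hxmeas.aemeasurable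
        (f := fun q : ℕ → Plane => ∏ i ∈ Finset.range n, f (q i)) hFm.aestronglyMeasurable]
    congr with q
    exact integral_prod_infinitePi _ n (f := fun i => g (q i))
      fun i => hgm.comp measurable_prodMk_left
  have hl : Filter.Tendsto (fun n => ∫ ω, ∏ i ∈ Finset.range n, g (x i ω) (m i ω) ∂μ) Filter.atTop
      (nhds (∫ ω, ∏ᶠ i, g (x i ω) (m i ω) ∂μ)) :=
    tendsto_integral_of_dominated_convergence (fun _ => 1)
      (fun n => (Finset.measurable_prod _ fun i _ =>
        hgm.comp ((h.measurable i).prodMk (hm i))).aestronglyMeasurable)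
      (integrable_const _) (fun n => Filter.Eventually.of_forall fun ω =>
        norm_prod_range_le_one (fun i => hg _ _) n)
      ((h.ae_finite_mulSupport hA hΛ hgA).mono fun ω hω => tendsto_prod_range_finprod hω)
  have hr : Filter.Tendsto (fun n => ∫ ω, ∏ i ∈ Finset.range n, f (x i ω) ∂μ) Filter.atTop
      (nhds (∫ ω, ∏ᶠ i, f (x i ω) ∂μ)) :=
    tendsto_integral_of_dominated_convergence (fun _ => 1)
      (fun n => (Finset.measurable_prod _ fun i _ =>
        hfm.comp (h.measurable i)).aestronglyMeasurable)
      (integrable_const _) (fun n => Filter.Eventually.of_forall fun ω =>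
        norm_prod_range_le_one (fun i => hf1 _) n)
      ((h.ae_finite_mulSupport hA hΛ (m := fun _ _ => ()) (g := fun y _ => f y)
        (fun y hy _ => hfA y hy)).mono fun ω hω => tendsto_prod_range_finprod hω)
  simp_rw [hfinite] at hl
  rw [tendsto_nhds_unique hl hr, h.integral_finprod hA hΛ hfm hf1 hfA]

end IsPoissonProcess

/-! ### Distances of the points of a homogeneous Poisson process -/

/-- The probability is `1 - exp (-r) (1 + r)`, and `exp (-r) ≥ 1 - r`. -/
theorem poissonMeasure_real_one_lt_le (r : ℝ≥0) :
    (poissonMeasure r).real {n : ℕ | 1 < n} ≤ (r : ℝ) ^ 2 := by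
  have h1 : {n : ℕ | 1 < n} = ({0, 1} : Set ℕ)ᶜ := by
    ext n; simp; omega
  have h2 : (poissonMeasure r).real ({0, 1} : Set ℕ) = Real.exp (-r) * (1 + r) := by
    rw [show ({0, 1} : Set ℕ) = {0} ∪ {1} from rfl, measureReal_union (by simp) (by simp),
      poissonMeasure_real_singleton, poissonMeasure_real_singleton]
    simp; ring
  rw [h1, probReal_compl_eq_one_sub (by simp), h2]
  have h3 := Real.add_one_le_exp (-(r : ℝ))
  nlinarith [r.coe_nonneg]

theorem volume_norm_sq_mem_Ico {a b : ℝ} (ha : 0 ≤ a) (hab : a ≤ b) :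
    (volume : Measure Plane) {y | ‖y‖ ^ 2 ∈ Ico a b} = ENNReal.ofReal (Real.pi * (b - a)) := by
  have h1 : {y : Plane | ‖y‖ ^ 2 ∈ Ico a b} =
      Metric.ball 0 (Real.sqrt b) \ Metric.ball 0 (Real.sqrt a) := by
    ext y
    simp [Real.lt_sqrt (norm_nonneg y), and_comm]
  rw [h1, measure_sdiff (Metric.ball_subset_ball (Real.sqrt_le_sqrt hab))
    measurableSet_ball.nullMeasurableSet measure_ball_lt_top.ne,
    EuclideanSpace.volume_ball_fin_two, EuclideanSpace.volume_ball_fin_two,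
    ← ENNReal.ofReal_pow (Real.sqrt_nonneg _), ← ENNReal.ofReal_pow (Real.sqrt_nonneg _),
    Real.sq_sqrt ha, Real.sq_sqrt (ha.trans hab)]
  rw [mul_sub, ENNReal.ofReal_sub _ (mul_nonneg Real.pi_pos.le ha),
    ENNReal.ofReal_mul Real.pi_pos.le, ENNReal.ofReal_mul Real.pi_pos.le, mul_comm,
    mul_comm (ENNReal.ofReal a)]

namespace IsPoissonProcess

variable {Ω : Type*} [MeasurableSpace Ω] {μ : Measure Ω} {x : ℕ → Ω → Plane} {Λ : Measure Plane}

theorem measureReal_one_lt_pointCount_le (h : IsPoissonProcess x Λ μ) {A : Set Plane}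
    (hA : MeasurableSet A) (hΛ : Λ A ≠ ∞) :
    μ.real {ω | 1 < pointCount x A ω} ≤ Λ.real A ^ 2 := by
  rw [(h.hasLaw_count A hA hΛ).measureReal_eq (p := fun n => 1 < n) (MeasurableSet.of_discrete),
    map_measureReal_apply Measurable.of_discrete MeasurableSet.of_discrete]
  have : (fun n : ℕ => (n : ℕ∞)) ⁻¹' {n | 1 < n} = {n : ℕ | 1 < n} := by
    ext n; simp
  rw [this]
  exact poissonMeasure_real_one_lt_le _

/-- Two points at equal distance lie in a common annulus of any partition of a disc. With `n + 1`
annuli of equal area, some annulus contains two points with probability at most `(n + 1) (c / (n +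
1)) ^ 2`, which tends to zero. -/
theorem ae_norm_ne [IsProbabilityMeasure μ] {l : ℝ} (hl : 0 ≤ l)
    (h : IsPoissonProcess x (ENNReal.ofReal l • (volume : Measure Plane)) μ) :
    ∀ᵐ ω ∂μ, ∀ i j, i ≠ j → ‖x i ω‖ ≠ ‖x j ω‖ := by
  set bad : ℕ → Set Ω := fun N => {ω | ∃ i j, i ≠ j ∧ ‖x i ω‖ = ‖x j ω‖ ∧ ‖x i ω‖ ^ 2 < N}
    with hbad
  have key : ∀ N, μ (bad N) = 0 := by
    intro N
    set c : ℝ := l * (Real.pi * N) with hc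
    have hbound : ∀ n : ℕ, μ.real (bad N) ≤ c ^ 2 * (1 / ((n : ℝ) + 1)) := by
      intro n
      have hn : (0 : ℝ) < (n : ℝ) + 1 := by positivity
      -- Area is proportional to the squared radius, so equal steps in `‖y‖ ^ 2` give equal areas.
      set A : ℕ → Set Plane := fun k =>
        {y | ‖y‖ ^ 2 ∈ Ico (k / ((n : ℝ) + 1) * N) ((k + 1) / ((n : ℝ) + 1) * N)} with hAdef
      have hAm : ∀ k, MeasurableSet (A k) := fun k =>
        (measurable_norm.pow_const 2) measurableSet_Ico
      have hAv : ∀ k, (ENNReal.ofReal l • (volume : Measure Plane)) (A k) =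
          ENNReal.ofReal (c / ((n : ℝ) + 1)) := by
        intro k
        rw [Measure.smul_apply, hAdef, volume_norm_sq_mem_Ico (by positivity) (by gcongr; linarith),
          smul_eq_mul, ← ENNReal.ofReal_mul hl]
        congr 1
        rw [hc]; field_simp; ring
      have hsub : bad N ⊆ ⋃ k ∈ Finset.range (n + 1), {ω | 1 < pointCount x (A k) ω} := by
        rintro ω ⟨i, j, hij, hnorm, hlt⟩
        have hN : (0 : ℝ) < N := (sq_nonneg _).trans_lt hlt
        set t := ‖x i ω‖ ^ 2 * ((n : ℝ) + 1) / N with ht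
        have ht0 : 0 ≤ t := by positivity
        have htn : t < (n : ℝ) + 1 := by
          rw [ht, div_lt_iff₀ hN]; nlinarith
        have hmem : ∀ i', ‖x i' ω‖ = ‖x i ω‖ → x i' ω ∈ A ⌊t⌋₊ := by
          intro i' hi'
          have h1 := Nat.floor_le ht0
          have h2 := Nat.lt_floor_add_one t
          have h3 : ‖x i' ω‖ ^ 2 = t / ((n : ℝ) + 1) * N := by
            rw [hi', ht]; field_simp
          change ‖x i' ω‖ ^ 2 ∈ Ico _ _
          rw [h3]
          exact ⟨by gcongr, by gcongr⟩
        simp only [mem_iUnion, Finset.mem_range]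
        refine ⟨⌊t⌋₊, ?_, ?_⟩
        · rw [Nat.floor_lt ht0]; exact_mod_cast htn
        · exact Set.one_lt_encard_iff.2 ⟨i, j, hmem i rfl, hmem j hnorm.symm, hij⟩
      calc μ.real (bad N) ≤ μ.real (⋃ k ∈ Finset.range (n + 1), {ω | 1 < pointCount x (A k) ω}) :=
            measureReal_mono hsub (measure_ne_top _ _)
        _ ≤ ∑ k ∈ Finset.range (n + 1), μ.real {ω | 1 < pointCount x (A k) ω} :=
            measureReal_biUnion_finset_le _ _
        _ ≤ ∑ k ∈ Finset.range (n + 1), (c / ((n : ℝ) + 1)) ^ 2 := by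
            refine Finset.sum_le_sum fun k _ => ?_
            refine (h.measureReal_one_lt_pointCount_le (hAm k) (by simp [hAv])).trans (le_of_eq ?_)
            rw [measureReal_def, hAv, ENNReal.toReal_ofReal (by positivity)]
        _ = c ^ 2 * (1 / ((n : ℝ) + 1)) := by
            rw [Finset.sum_const, Finset.card_range, nsmul_eq_mul]
            push_cast; field_simp
    have hlim : Filter.Tendsto (fun n : ℕ => c ^ 2 * (1 / ((n : ℝ) + 1))) Filter.atTop (nhds 0) := by
      simpa using (tendsto_one_div_add_atTop_nhds_zero_nat (𝕜 := ℝ)).const_mul (c ^ 2)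
    have := ge_of_tendsto' hlim hbound
    exact (measureReal_eq_zero_iff).1 (le_antisymm this measureReal_nonneg)
  have hall : ∀ᵐ ω ∂μ, ∀ N, ω ∉ bad N := ae_all_iff.2 fun N => measure_eq_zero_iff_ae_notMem.1 (key N)
  filter_upwards [hall] with ω hω i j hij hnorm
  obtain ⟨N, hN⟩ := exists_nat_gt (‖x i ω‖ ^ 2)
  exact hω N ⟨i, j, hij, hnorm, hN⟩

end IsPoissonProcess

/-! ### The aggregate interference -/

namespace RISNetwork

variable {p : NetworkParams} {Ω : Type*} [MeasurableSpace Ω] {μ : Measure Ω} (N : RISNetwork p μ)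

/-- The intensity measure of the BSs. -/
noncomputable abbrev intensity (p : NetworkParams) : Measure Plane :=
  ENNReal.ofReal p.densBS • (volume : Measure Plane)

instance : SigmaFinite (intensity p) :=
  have := IsFiniteMeasureOnCompacts.smul (volume : Measure Plane) (c := ENNReal.ofReal p.densBS)
    ENNReal.ofReal_ne_top
  inferInstance

/-- Positive part of the power received from the `i`-th cell. -/
noncomputable def posPower (i : ℕ) (ω : Ω) : ℝ := max 0 (p.cellPower (N.bs i ω) (N.mark i ω))

/-- Aggregate power from the cells at distance greater than `b`. -/
noncomputable def tail (b : ℝ) (ω : Ω) : ℝ :=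
  ∑' i, if b < ‖N.bs i ω‖ then N.posPower i ω else 0

theorem posPower_nonneg (i : ℕ) (ω : Ω) : 0 ≤ N.posPower i ω := le_max_left _ _

theorem measurable_posPower (i : ℕ) : Measurable (N.posPower i) :=
  measurable_const.max (p.measurable_cellPower.comp
    ((N.poisson_bs.measurable i).prodMk (N.measurable_mark i)))

theorem ae_mark {P : NetworkParams.CellMark → Prop} (h : ∀ᵐ m ∂p.cellMarkLaw, P m) :
    ∀ᵐ ω ∂μ, ∀ i, P (N.mark i ω) := by
  refine ae_all_iff.2 fun i => ?_
  have := N.hasLaw_mark i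
  rw [← this.map_eq] at h
  exact ae_of_ae_map this.aemeasurable h

/-- Truncation at zero changes nothing almost surely. It makes nonnegativity, and with it the bound
one on the exponentials, hold at every `ω`. -/
theorem ae_posPower_eq :
    ∀ᵐ ω ∂μ, ∀ i, N.posPower i ω = p.cellPower (N.bs i ω) (N.mark i ω) :=
  (N.ae_mark p.ae_cellPower_nonneg).mono fun _ hω i => max_eq_right (hω i _)

/-! ### Almost sure convergence, and the interference as a tail beyond the serving distance. -/

/-- Position and mark of a cell are independent, so its mean power is at most the mean path loss
times the mean of `cellDominant`. Campbell's formula sums the path losses to an integral over the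
plane. -/
theorem ae_summable_posPower : ∀ᵐ ω ∂μ, Summable fun i => N.posPower i ω := by
  have hgm : Measurable fun a : Plane => ENNReal.ofReal (p.pathLoss ‖a‖) := by fun_prop
  set E := ∫⁻ m, p.cellDominant m ∂p.cellMarkLaw with hE
  have hi : ∀ i, ∫⁻ ω, ENNReal.ofReal (N.posPower i ω) ∂μ ≤
      (∫⁻ a, ENNReal.ofReal (p.pathLoss ‖a‖) ∂μ.map (N.bs i)) * E := by
    intro i
    have hind : IndepFun (N.bs i) (N.mark i) μ :=
      N.indep_bs_mark.comp (measurable_pi_apply i) (measurable_pi_apply i)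
    calc ∫⁻ ω, ENNReal.ofReal (N.posPower i ω) ∂μ
        ≤ ∫⁻ ω, ENNReal.ofReal (p.pathLoss ‖N.bs i ω‖) * p.cellDominant (N.mark i ω) ∂μ := by
          refine lintegral_mono_ae ?_
          filter_upwards [N.ae_posPower_eq, N.ae_mark p.ae_cellPower_le] with ω h1 h2
          rw [h1]; exact h2 i _
      _ = (∫⁻ ω, ENNReal.ofReal (p.pathLoss ‖N.bs i ω‖) ∂μ) *
            ∫⁻ ω, p.cellDominant (N.mark i ω) ∂μ :=
          lintegral_mul_eq_lintegral_mul_lintegral_of_indepFun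
            (hgm.comp (N.poisson_bs.measurable i))
            (p.measurable_cellDominant.comp (N.measurable_mark i))
            (hind.comp hgm p.measurable_cellDominant)
      _ = _ := by
          rw [lintegral_map hgm (N.poisson_bs.measurable i), hE,
            (N.hasLaw_mark i).lintegral_comp p.measurable_cellDominant.aemeasurable]
  have hsum : ∫⁻ ω, ∑' i, ENNReal.ofReal (N.posPower i ω) ∂μ ≠ ∞ := by
    rw [lintegral_tsum fun i => (N.measurable_posPower i).ennreal_ofReal.aemeasurable]
    refine ne_top_of_le_ne_top ?_ (ENNReal.tsum_le_tsum hi)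
    rw [ENNReal.tsum_mul_right, ← lintegral_sum_measure, N.poisson_bs.sum_map_eq,
      lintegral_smul_measure]
    refine ENNReal.mul_ne_top (ENNReal.mul_ne_top ENNReal.ofReal_ne_top ?_)
      p.lintegral_cellDominant_ne_top
    have := p.integrable_pathLoss.2
    rw [hasFiniteIntegral_iff_ofReal
      (Filter.Eventually.of_forall fun a => p.pathLoss_nonneg (norm_nonneg a))] at this
    exact this.ne
  have hae := ae_lt_top (Measurable.tsum fun i => (N.measurable_posPower i).ennreal_ofReal) hsum
  filter_upwards [hae] with ω hω
  have := ENNReal.summable_toReal hω.ne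
  simpa only [ENNReal.toReal_ofReal (N.posPower_nonneg _ _)] using this

theorem ae_summable_interferer : ∀ᵐ ω ∂μ, Summable fun i => N.interferer i ω := by
  filter_upwards [N.ae_summable_posPower, N.ae_posPower_eq] with ω h1 h2
  refine Summable.of_norm_bounded h1 fun i => ?_
  rw [interferer]
  split_ifs
  · simpa using N.posPower_nonneg i ω
  · rw [← h2, Real.norm_of_nonneg (N.posPower_nonneg i ω)]

theorem measurable_servingDist : Measurable N.servingDist := by
  have h : Measurable fun q : ℕ × Ω => N.bs q.1 q.2 :=
    measurable_from_prod_countable_right fun i => N.poisson_bs.measurable i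
  exact (h.comp (N.measurable_serving.prodMk measurable_id)).norm

theorem measurable_tail {t : Ω → ℝ} (ht : Measurable t) : Measurable fun ω => N.tail (t ω) ω := by
  unfold tail
  refine Measurable.tsum fun i => Measurable.ite ?_ (N.measurable_posPower i) measurable_const
  exact measurableSet_lt ht (N.poisson_bs.measurable i).norm

theorem tail_nonneg (b : ℝ) (ω : Ω) : 0 ≤ N.tail b ω :=
  tsum_nonneg fun i => by split_ifs; exacts [N.posPower_nonneg i ω, le_rfl]

/-- Without ties, every BS other than the serving one is strictly farther than the serving distance,
while the strict inequality in `tail` excludes the serving BS. -/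
theorem ae_interference_eq [IsProbabilityMeasure μ] :
    ∀ᵐ ω ∂μ, N.interference ω = N.tail (N.servingDist ω) ω := by
  filter_upwards [N.ae_posPower_eq, N.poisson_bs.ae_norm_ne p.densBS_pos.le,
    N.serving_nearest] with ω h1 h2 h3
  unfold interference tail
  congr with i
  rw [interferer, servingDist]
  by_cases hi : i = N.serving ω
  · simp [hi]
  · rw [if_neg hi, if_pos (lt_of_le_of_ne (h3 i) (h2 _ _ (Ne.symm hi))), h1]

/-! ### Tail transforms on the event that the nearest BS is farther than `a`. -/

theorem intensity_closedBall_ne_top (R : ℝ) : intensity p (Metric.closedBall 0 R) ≠ ∞ :=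
  ENNReal.mul_ne_top ENNReal.ofReal_ne_top measure_closedBall_lt_top.ne

theorem integrable_one_sub_cellLaplace_intensity {s : ℂ} (hs : 0 ≤ s.re) :
    Integrable (fun a : Plane => 1 - p.cellLaplace a s) (intensity p) :=
  (p.integrable_one_sub_cellLaplace hs).smul_measure ENNReal.ofReal_ne_top

/-- Laplace transform of the power from the cells at distance greater than `b`. -/
noncomputable def tailLaplace (p : NetworkParams) (s : ℂ) (b : ℝ) : ℂ :=
  Complex.exp (-∫ y in {y : Plane | b < ‖y‖}, (1 - p.cellLaplace y s) ∂intensity p)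

theorem measurableSet_norm_gt (b : ℝ) : MeasurableSet {y : Plane | b < ‖y‖} :=
  measurableSet_lt measurable_const measurable_norm

/-- The test function is `0` on the ball of radius `a`, the exponential on the shell, and `1`
elsewhere. The zero encodes the indicator of `{a < servingDist}`, and `a ≤ b` keeps ball and shell
disjoint. The outer radius `R` keeps the intensity finite. -/
theorem setIntegral_shell [IsProbabilityMeasure μ] {s : ℂ} (hs : 0 ≤ s.re) {a b : ℝ} (hab : a ≤ b)
    (R : ℝ) :
    ∫ ω in {ω | a < N.servingDist ω}, Complex.exp (-s * ((p.T *
        ∑' i, (if b < ‖N.bs i ω‖ ∧ ‖N.bs i ω‖ ≤ R then N.posPower i ω else 0) : ℝ) : ℂ)) ∂μ =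
      Complex.exp (-((intensity p).real (Metric.closedBall 0 a) : ℂ)) *
        Complex.exp (-∫ y in {y : Plane | b < ‖y‖ ∧ ‖y‖ ≤ R},
          (1 - p.cellLaplace y s) ∂intensity p) := by
  classical
  set D : Set Plane := Metric.closedBall 0 a with hD
  set S : Set Plane := {y | b < ‖y‖ ∧ ‖y‖ ≤ R} with hS
  have hDm : MeasurableSet D := Metric.isClosed_closedBall.measurableSet
  have hSm : MeasurableSet S := (measurableSet_norm_gt b).inter
    (measurableSet_le measurable_norm measurable_const)
  have hDS : ∀ y ∈ D, y ∉ S := fun y hy hy' => by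
    have h1 : ‖y‖ ≤ a := by simpa [hD] using hy
    exact absurd hy'.1 (by linarith)
  have hA : MeasurableSet (D ∪ S) := hDm.union hSm
  have hΛ : intensity p (D ∪ S) ≠ ∞ := by
    refine ((measure_mono ?_).trans_lt (intensity_closedBall_ne_top (p := p) (max a R)).lt_top).ne
    rintro y (hy | hy)
    · exact Metric.closedBall_subset_closedBall (le_max_left _ _) hy
    · simpa using Or.inr hy.2
  set e : Plane → NetworkParams.CellMark → ℂ := fun y m =>
    Complex.exp (-s * ((p.T * max 0 (p.cellPower y m) : ℝ) : ℂ)) with he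
  set g : Plane → NetworkParams.CellMark → ℂ := fun y m =>
    if y ∈ D then 0 else if y ∈ S then e y m else 1 with hg
  have hem : Measurable (Function.uncurry e) := by
    have := p.measurable_cellPower
    simp only [he, Function.uncurry_def]
    fun_prop
  have hgm : Measurable (Function.uncurry g) :=
    Measurable.ite (measurable_fst hDm) measurable_const
      (Measurable.ite (measurable_fst hSm) hem measurable_const)
  have hg1 : ∀ y m, ‖g y m‖ ≤ 1 := by
    intro y m
    simp only [hg]
    split_ifs
    · simp
    · exact p.norm_cexp_neg_mul_T_le_one hs (le_max_left _ _)
    · simp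
  have hgA : ∀ y ∉ D ∪ S, ∀ m, g y m = 1 := by
    intro y hy m
    rw [mem_union, not_or] at hy
    simp [hg, hy.1, hy.2]
  have hmain := N.poisson_bs.integral_finprod_mark hA hΛ N.measurable_mark N.hasLaw_mark
    N.indep_mark N.indep_bs_mark hgm hg1 hgA
  have hlhs : ∫ ω, ∏ᶠ i, g (N.bs i ω) (N.mark i ω) ∂μ =
      ∫ ω in {ω | a < N.servingDist ω}, Complex.exp (-s * ((p.T *
        ∑' i, (if b < ‖N.bs i ω‖ ∧ ‖N.bs i ω‖ ≤ R then N.posPower i ω else 0) : ℝ) : ℂ)) ∂μ := by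
    rw [← integral_indicator (measurableSet_lt measurable_const N.measurable_servingDist)]
    refine integral_congr_ae ?_
    filter_upwards [N.poisson_bs.ae_finite hA hΛ, N.serving_nearest] with ω hfin hnear
    have hms : (Function.mulSupport fun i => g (N.bs i ω) (N.mark i ω)) ⊆ hfin.toFinset := by
      intro i hi
      rw [Finite.coe_toFinset]
      by_contra hi'
      exact hi (hgA _ hi' _)
    by_cases ha : a < N.servingDist ω
    · rw [indicator_of_mem (by exact ha)]
      have hnD : ∀ i, N.bs i ω ∉ D := fun i hi => by
        have h1 : ‖N.bs i ω‖ ≤ a := by simpa [hD] using hi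
        exact absurd (hnear i) (not_le.2 (h1.trans_lt ha))
      rw [finprod_eq_prod_of_mulSupport_subset _ hms, tsum_eq_sum (s := hfin.toFinset),
        Finset.mul_sum, Complex.ofReal_sum, Finset.mul_sum, Complex.exp_sum]
      · refine Finset.prod_congr rfl fun i _ => ?_
        simp only [hg, if_neg (hnD i)]
        by_cases hiS : N.bs i ω ∈ S
        · rw [if_pos hiS, if_pos (by exact hiS)]; rfl
        · rw [if_neg hiS, if_neg (by exact hiS)]; simp
      · intro i hi
        rw [Finite.mem_toFinset] at hi
        exact if_neg fun h' => hi (Or.inr h')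
    · rw [indicator_of_notMem (by exact ha)]
      -- The serving BS lies in the ball and contributes a zero factor. Finiteness of the support
      -- matters, since otherwise `finprod` would be one.
      refine finprod_eq_zero _ (N.serving ω) ?_ (hfin.toFinset.finite_toSet.subset hms)
      have : N.bs (N.serving ω) ω ∈ D := by
        simpa [hD, servingDist] using ha
      simp [hg, this]
  have hint : ∀ y, ∫ m, g y m ∂p.cellMarkLaw =
      if y ∈ D then 0 else if y ∈ S then p.cellLaplace y s else 1 := by
    intro y
    simp only [hg]
    split_ifs
    · simp
    · refine integral_congr_ae (p.ae_cellPower_nonneg.mono fun m hm => ?_)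
      simp only [he, max_eq_right (hm y)]
    · simp
  have hrhs : ∫ y in D ∪ S, (1 - ∫ m, g y m ∂p.cellMarkLaw) ∂intensity p =
      ((intensity p).real D : ℂ) + ∫ y in S, (1 - p.cellLaplace y s) ∂intensity p := by
    have hdisj : Disjoint D S := disjoint_left.2 hDS
    have hc : ∀ y ∈ D, (1 - ∫ m, g y m ∂p.cellMarkLaw) = 1 := fun y hy => by
      rw [hint, if_pos hy, sub_zero]
    have hc' : ∀ y ∈ S, (1 - ∫ m, g y m ∂p.cellMarkLaw) = 1 - p.cellLaplace y s := fun y hy => by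
      rw [hint, if_neg fun h' => hDS y h' hy, if_pos hy]
    have hDtop : intensity p D ≠ ∞ := intensity_closedBall_ne_top a
    rw [setIntegral_union hdisj hSm, setIntegral_congr_fun hDm hc, setIntegral_congr_fun hSm hc']
    · simp
    · exact (integrableOn_const hDtop).congr_fun (fun y hy => (hc y hy).symm) hDm
    · exact (integrable_one_sub_cellLaplace_intensity hs).integrableOn.congr_fun
        (fun y hy => (hc' y hy).symm) hSm
  rw [← hlhs, hmain, hrhs, neg_add, Complex.exp_add]

/-- The limit `R → ∞` of the shell identity: dominated by the summable powers on the left and by the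
integrable `1 - cellLaplace` on the right. -/
theorem setIntegral_tail_aux [IsProbabilityMeasure μ] {s : ℂ} (hs : 0 ≤ s.re) {a b : ℝ}
    (hab : a ≤ b) :
    ∫ ω in {ω | a < N.servingDist ω}, Complex.exp (-s * ((p.T * N.tail b ω : ℝ) : ℂ)) ∂μ =
      Complex.exp (-((intensity p).real (Metric.closedBall 0 a) : ℂ)) * tailLaplace p s b := by
  set f : ℕ → Ω → ℕ → ℝ := fun n ω i =>
    if b < ‖N.bs i ω‖ ∧ ‖N.bs i ω‖ ≤ n then N.posPower i ω else 0 with hf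
  have hf0 : ∀ n ω i, 0 ≤ f n ω i := fun n ω i => by
    simp only [hf]; split_ifs; exacts [N.posPower_nonneg i ω, le_rfl]
  have hfle : ∀ n ω i, f n ω i ≤ N.posPower i ω := fun n ω i => by
    simp only [hf]; split_ifs; exacts [le_rfl, N.posPower_nonneg i ω]
  have hfm : ∀ n, Measurable fun ω => ∑' i, f n ω i := fun n =>
    Measurable.tsum fun i => Measurable.ite
      ((measurableSet_lt measurable_const (N.poisson_bs.measurable i).norm).inter
        (measurableSet_le (N.poisson_bs.measurable i).norm measurable_const))
      (N.measurable_posPower i) measurable_const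
  have hl : Filter.Tendsto (fun n : ℕ => ∫ ω in {ω | a < N.servingDist ω},
      Complex.exp (-s * ((p.T * ∑' i, f n ω i : ℝ) : ℂ)) ∂μ) Filter.atTop
      (nhds (∫ ω in {ω | a < N.servingDist ω},
        Complex.exp (-s * ((p.T * N.tail b ω : ℝ) : ℂ)) ∂μ)) := by
    refine tendsto_integral_of_dominated_convergence (fun _ => 1) (fun n => ?_)
      (integrable_const _) (fun n => Filter.Eventually.of_forall fun ω =>
        p.norm_cexp_neg_mul_T_le_one hs (tsum_nonneg (hf0 n ω))) ?_
    · have := hfm n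
      exact Measurable.aestronglyMeasurable (by fun_prop)
    · refine ae_restrict_of_ae ?_
      filter_upwards [N.ae_summable_posPower] with ω hω
      have ht : Filter.Tendsto (fun n => ∑' i, f n ω i) Filter.atTop (nhds (N.tail b ω)) := by
        refine tendsto_tsum_of_dominated_convergence hω (fun i => ?_)
          (Filter.Eventually.of_forall fun n i => ?_)
        · obtain ⟨n₀, hn₀⟩ := exists_nat_ge ‖N.bs i ω‖
          refine tendsto_const_nhds.congr' ?_
          filter_upwards [Filter.eventually_ge_atTop n₀] with n hn
          have : ‖N.bs i ω‖ ≤ n := hn₀.trans (by exact_mod_cast hn)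
          simp [hf, this]
        · rw [Real.norm_of_nonneg (hf0 n ω i)]; exact hfle n ω i
      have hc : Continuous fun t : ℝ => Complex.exp (-s * ((p.T * t : ℝ) : ℂ)) := by fun_prop
      exact (hc.tendsto _).comp ht
  have hr : Filter.Tendsto (fun n : ℕ =>
      Complex.exp (-((intensity p).real (Metric.closedBall 0 a) : ℂ)) *
        Complex.exp (-∫ y in {y : Plane | b < ‖y‖ ∧ ‖y‖ ≤ n},
          (1 - p.cellLaplace y s) ∂intensity p)) Filter.atTop
      (nhds (Complex.exp (-((intensity p).real (Metric.closedBall 0 a) : ℂ)) *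
        tailLaplace p s b)) := by
    refine Filter.Tendsto.const_mul _ ((Complex.continuous_exp.tendsto _).comp
      (Filter.Tendsto.neg ?_))
    have hU : (⋃ n : ℕ, {y : Plane | b < ‖y‖ ∧ ‖y‖ ≤ n}) = {y : Plane | b < ‖y‖} := by
      ext y
      simp only [mem_iUnion, mem_ofPred_eq, exists_and_left, and_iff_left_iff_imp]
      exact fun _ => exists_nat_ge _
    rw [← hU]
    refine tendsto_setIntegral_of_monotone (fun n => (measurableSet_norm_gt b).inter
      (measurableSet_le measurable_norm measurable_const)) (fun m n hmn y hy => ?_)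
      (integrable_one_sub_cellLaplace_intensity hs).integrableOn
    exact ⟨hy.1, hy.2.trans (by exact_mod_cast hmn)⟩
  simp_rw [hf, fun n : ℕ => N.setIntegral_shell hs hab n] at hl
  exact tendsto_nhds_unique hl hr

theorem cellLaplace_zero (a : Plane) : p.cellLaplace a 0 = 1 := by
  simp [NetworkParams.cellLaplace]

/-- The void probability of the ball, obtained at `s = 0`, where the tail factor is one. -/
theorem measureReal_servingDist_gt [IsProbabilityMeasure μ] (a : ℝ) :
    ((μ.real {ω | a < N.servingDist ω} : ℝ) : ℂ) =
      Complex.exp (-((intensity p).real (Metric.closedBall 0 a) : ℂ)) := by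
  have := N.setIntegral_tail_aux (s := 0) (by simp) (le_refl a)
  simpa [tailLaplace, cellLaplace_zero] using this

theorem setIntegral_tail_gt [IsProbabilityMeasure μ] {s : ℂ} (hs : 0 ≤ s.re) {a b : ℝ}
    (hab : a ≤ b) :
    ∫ ω in {ω | a < N.servingDist ω}, Complex.exp (-s * ((p.T * N.tail b ω : ℝ) : ℂ)) ∂μ =
      μ.real {ω | a < N.servingDist ω} * tailLaplace p s b := by
  rw [N.setIntegral_tail_aux hs hab, N.measureReal_servingDist_gt]

theorem integrable_tail [IsProbabilityMeasure μ] {s : ℂ} (hs : 0 ≤ s.re) {t : Ω → ℝ}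
    (ht : Measurable t) :
    Integrable (fun ω => Complex.exp (-s * ((p.T * N.tail (t ω) ω : ℝ) : ℂ))) μ := by
  have := N.measurable_tail ht
  exact Integrable.of_bound (Measurable.aestronglyMeasurable (by fun_prop)) 1
    (Filter.Eventually.of_forall fun ω => p.norm_cexp_neg_mul_T_le_one hs (N.tail_nonneg _ _))

/-- Difference of the identities on `{a < r}` and `{b < r}`, both with the same cutoff `b`. -/
theorem setIntegral_tail_Ioc [IsProbabilityMeasure μ] {s : ℂ} (hs : 0 ≤ s.re) {a b : ℝ}
    (hab : a ≤ b) :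
    ∫ ω in N.servingDist ⁻¹' Ioc a b, Complex.exp (-s * ((p.T * N.tail b ω : ℝ) : ℂ)) ∂μ =
      μ.real (N.servingDist ⁻¹' Ioc a b) * tailLaplace p s b := by
  have hset : N.servingDist ⁻¹' Ioc a b =
      {ω | a < N.servingDist ω} \ {ω | b < N.servingDist ω} := by
    ext ω; simp
  have hm : ∀ c, MeasurableSet {ω | c < N.servingDist ω} := fun c =>
    measurableSet_lt measurable_const N.measurable_servingDist
  have hsub : {ω | b < N.servingDist ω} ⊆ {ω | a < N.servingDist ω} := fun ω hω =>
    lt_of_le_of_lt hab hω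
  rw [hset, setIntegral_sdiff (hm b) (N.integrable_tail hs measurable_const).integrableOn hsub,
    N.setIntegral_tail_gt hs hab, N.setIntegral_tail_gt hs le_rfl,
    measureReal_sdiff hsub (hm b) (measure_ne_top _ _)]
  push_cast; ring

/-- Since `‖cellLaplace‖ ≤ 1`, the integrand `1 - cellLaplace` has nonnegative real part. -/
theorem norm_tailLaplace_le_one {s : ℂ} (hs : 0 ≤ s.re) (b : ℝ) : ‖tailLaplace p s b‖ ≤ 1 := by
  rw [tailLaplace, Complex.norm_exp, Real.exp_le_one_iff, Complex.neg_re, Left.neg_nonpos_iff]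
  have h := integral_re (μ := (intensity p).restrict {y : Plane | b < ‖y‖})
    (integrable_one_sub_cellLaplace_intensity (p := p) hs).integrableOn
  simp only [RCLike.re_to_complex] at h
  rw [← h]
  refine integral_nonneg fun y => ?_
  have := (Complex.re_le_norm _).trans (p.norm_cellLaplace_le_one y hs)
  simpa using this

theorem measurable_tailLaplace (s : ℂ) : Measurable (tailLaplace p s) := by
  have h : Measurable fun b : ℝ => ∫ y : Plane,
      {q : ℝ × Plane | q.1 < ‖q.2‖}.indicator (fun q => 1 - p.cellLaplace q.2 s) (b, y)
        ∂intensity p := by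
    refine (StronglyMeasurable.integral_prod_right' (Measurable.stronglyMeasurable ?_)).measurable
    exact (measurable_const.sub ((p.measurable_cellLaplace s).comp measurable_snd)).indicator
      (measurableSet_lt measurable_fst measurable_snd.norm)
  refine Complex.measurable_exp.comp (Measurable.neg ?_)
  convert h using 2 with b
  rw [← integral_indicator (measurableSet_norm_gt b)]
  rfl

/-! ### Replacing the fixed cutoff by the serving distance. -/

/-- Right-continuity only: the region `r < ‖y‖` is open at `r`, so it is exhausted by cutoffs
decreasing to `r`. This is why the grid rounds upwards. -/
theorem tendsto_tailLaplace {s : ℂ} (hs : 0 ≤ s.re) {r : ℝ} {t : ℕ → ℝ}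
    (ht : Filter.Tendsto t Filter.atTop (nhds r)) (hr : ∀ n, r ≤ t n) :
    Filter.Tendsto (fun n => tailLaplace p s (t n)) Filter.atTop (nhds (tailLaplace p s r)) := by
  refine (Complex.continuous_exp.tendsto _).comp (Filter.Tendsto.neg ?_)
  simp_rw [← integral_indicator (measurableSet_norm_gt _)]
  refine tendsto_integral_of_dominated_convergence (fun y => ‖1 - p.cellLaplace y s‖)
    (fun n => ((measurable_const.sub (p.measurable_cellLaplace s)).indicator
      (measurableSet_norm_gt _)).aestronglyMeasurable)
    (integrable_one_sub_cellLaplace_intensity hs).norm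
    (fun n => Filter.Eventually.of_forall fun y => norm_indicator_le_norm_self _ _)
    (Filter.Eventually.of_forall fun y => ?_)
  refine tendsto_const_nhds.congr' ?_
  by_cases hy : r < ‖y‖
  · filter_upwards [ht.eventually_lt_const hy] with n hn
    rw [indicator_of_mem (by exact hy), indicator_of_mem (by exact hn)]
  · refine Filter.Eventually.of_forall fun n => ?_
    beta_reduce
    rw [indicator_of_notMem (by exact hy),
      indicator_of_notMem (by exact fun h' => hy ((hr n).trans_lt h'))]

theorem tendsto_tail {ω : Ω} (hω : Summable fun i => N.posPower i ω) {r : ℝ} {t : ℕ → ℝ}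
    (ht : Filter.Tendsto t Filter.atTop (nhds r)) (hr : ∀ n, r ≤ t n) :
    Filter.Tendsto (fun n => N.tail (t n) ω) Filter.atTop (nhds (N.tail r ω)) := by
  refine tendsto_tsum_of_dominated_convergence hω (fun i => ?_)
    (Filter.Eventually.of_forall fun n i => ?_)
  · refine tendsto_const_nhds.congr' ?_
    by_cases hi : r < ‖N.bs i ω‖
    · filter_upwards [ht.eventually_lt_const hi] with n hn
      rw [if_pos hi, if_pos hn]
    · refine Filter.Eventually.of_forall fun n => ?_
      beta_reduce
      rw [if_neg hi, if_neg fun h' => hi ((hr n).trans_lt h')]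
  · split_ifs
    · rw [Real.norm_of_nonneg (N.posPower_nonneg i ω)]
    · simpa using N.posPower_nonneg i ω

/-- The smallest point of the grid `c + h ℕ` that is at least `r`. -/
noncomputable def gridCeil (c h r : ℝ) : ℝ := c + ⌈(r - c) / h⌉₊ * h

theorem measurable_gridCeil (c h : ℝ) : Measurable (gridCeil c h) := by
  unfold gridCeil
  have : Measurable fun r : ℝ => ⌈(r - c) / h⌉₊ :=
    Nat.measurable_ceil.comp (by fun_prop)
  exact measurable_const.add ((measurable_from_nat.comp this).mul_const h)

theorem le_gridCeil {c h : ℝ} (hh : 0 < h) (r : ℝ) : r ≤ gridCeil c h r := by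
  have := Nat.le_ceil ((r - c) / h)
  rw [div_le_iff₀ hh] at this
  unfold gridCeil; linarith

theorem gridCeil_le {c h r : ℝ} (hh : 0 < h) (hr : c < r) : gridCeil c h r ≤ r + h := by
  have h1 := (Nat.ceil_lt_add_one (div_nonneg (sub_nonneg.2 hr.le) hh.le)).le
  have h2 := mul_le_mul_of_nonneg_right h1 hh.le
  rw [add_mul, div_mul_cancel₀ _ hh.ne', one_mul] at h2
  unfold gridCeil; linarith

theorem tendsto_gridCeil {c r : ℝ} (hr : c < r) :
    Filter.Tendsto (fun n : ℕ => gridCeil c (1 / ((n : ℝ) + 1)) r) Filter.atTop (nhds r) := by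
  have hpos : ∀ n : ℕ, 0 < 1 / ((n : ℝ) + 1) := fun n => by positivity
  have h2 : Filter.Tendsto (fun n : ℕ => r + 1 / ((n : ℝ) + 1)) Filter.atTop (nhds r) := by
    simpa using (tendsto_one_div_add_atTop_nhds_zero_nat (𝕜 := ℝ)).const_add r
  exact tendsto_of_tendsto_of_tendsto_of_le_of_le tendsto_const_nhds h2
    (fun n => le_gridCeil (hpos n) r) (fun n => gridCeil_le (hpos n) hr)

theorem integrable_tailLaplace [IsProbabilityMeasure μ] {s : ℂ} (hs : 0 ≤ s.re) {t : Ω → ℝ}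
    (ht : Measurable t) : Integrable (fun ω => tailLaplace p s (t ω)) μ :=
  Integrable.of_bound ((measurable_tailLaplace s).comp ht).aestronglyMeasurable 1
    (Filter.Eventually.of_forall fun _ => norm_tailLaplace_le_one hs _)

/-- On each cell `(c + j h, c + (j + 1) h]` the rounded distance is the right endpoint, so
`setIntegral_tail_Ioc` applies with a deterministic cutoff. The cells partition `{r > c}`. -/
theorem setIntegral_gridCeil [IsProbabilityMeasure μ] {s : ℂ} (hs : 0 ≤ s.re) (c : ℝ) {h : ℝ}
    (hh : 0 < h) :
    ∫ ω in N.servingDist ⁻¹' Ioi c, Complex.exp (-s *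
        ((p.T * N.tail (gridCeil c h (N.servingDist ω)) ω : ℝ) : ℂ)) ∂μ =
      ∫ ω in N.servingDist ⁻¹' Ioi c, tailLaplace p s (gridCeil c h (N.servingDist ω)) ∂μ := by
  set A : ℕ → Set Ω := fun j => N.servingDist ⁻¹' Ioc (c + j * h) (c + (j + 1) * h) with hA
  have hAm : ∀ j, MeasurableSet (A j) := fun j => N.measurable_servingDist measurableSet_Ioc
  have hgrid : ∀ j, ∀ ω ∈ A j, gridCeil c h (N.servingDist ω) = c + (j + 1) * h := by
    intro j ω hω
    have h1 : ⌈(N.servingDist ω - c) / h⌉₊ = j + 1 := by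
      rw [Nat.ceil_eq_iff (Nat.succ_ne_zero j), Nat.succ_sub_one, lt_div_iff₀ hh, div_le_iff₀ hh]
      push_cast
      exact ⟨by linarith [hω.1], by linarith [hω.2]⟩
    rw [gridCeil, h1]; push_cast; rfl
  have hAd : Pairwise (Function.onFun Disjoint A) := by
    intro j k hjk
    refine disjoint_left.2 fun ω hj hk => hjk ?_
    have := (hgrid j ω hj).symm.trans (hgrid k ω hk)
    have h2 := mul_right_cancel₀ hh.ne' (add_left_cancel this)
    exact_mod_cast add_right_cancel h2
  have hU : N.servingDist ⁻¹' Ioi c = ⋃ j, A j := by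
    ext ω
    simp only [mem_preimage, mem_Ioi, mem_iUnion, hA, mem_Ioc]
    constructor
    · intro hω
      have hpos : 0 < (N.servingDist ω - c) / h := div_pos (sub_pos.2 hω) hh
      obtain ⟨j, hj⟩ := Nat.exists_eq_succ_of_ne_zero (Nat.ceil_pos.2 hpos).ne'
      refine ⟨j, ?_⟩
      rw [Nat.succ_eq_add_one, Nat.ceil_eq_iff (Nat.succ_ne_zero j), Nat.succ_sub_one,
        lt_div_iff₀ hh, div_le_iff₀ hh] at hj
      push_cast at hj
      exact ⟨by linarith [hj.1], by linarith [hj.2]⟩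
    · rintro ⟨j, hj, -⟩
      have : 0 ≤ (j : ℝ) * h := by positivity
      linarith
  have htm : Measurable fun ω => gridCeil c h (N.servingDist ω) :=
    (measurable_gridCeil c h).comp N.measurable_servingDist
  rw [hU, integral_iUnion hAm hAd (N.integrable_tail hs htm).integrableOn,
    integral_iUnion hAm hAd (integrable_tailLaplace hs htm).integrableOn]
  congr with j
  have hl : ∫ ω in A j, Complex.exp (-s *
        ((p.T * N.tail (gridCeil c h (N.servingDist ω)) ω : ℝ) : ℂ)) ∂μ =
      ∫ ω in A j, Complex.exp (-s * ((p.T * N.tail (c + (j + 1) * h) ω : ℝ) : ℂ)) ∂μ :=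
    setIntegral_congr_fun (hAm j) fun ω hω => by simp only [hgrid j ω hω]
  have hr : ∫ ω in A j, tailLaplace p s (gridCeil c h (N.servingDist ω)) ∂μ =
      ∫ ω in A j, tailLaplace p s (c + (j + 1) * h) ∂μ :=
    setIntegral_congr_fun (hAm j) fun ω hω => by simp only [hgrid j ω hω]
  rw [hl, hr, N.setIntegral_tail_Ioc hs (by nlinarith), setIntegral_const, Complex.real_smul]

theorem setIntegral_tail_Ioi [IsProbabilityMeasure μ] {s : ℂ} (hs : 0 ≤ s.re) (c : ℝ) :
    ∫ ω in N.servingDist ⁻¹' Ioi c, Complex.exp (-s *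
        ((p.T * N.tail (N.servingDist ω) ω : ℝ) : ℂ)) ∂μ =
      ∫ ω in N.servingDist ⁻¹' Ioi c, tailLaplace p s (N.servingDist ω) ∂μ := by
  have hpos : ∀ n : ℕ, 0 < 1 / ((n : ℝ) + 1) := fun n => by positivity
  have htm : ∀ n : ℕ, Measurable fun ω => gridCeil c (1 / ((n : ℝ) + 1)) (N.servingDist ω) :=
    fun n => (measurable_gridCeil c _).comp N.measurable_servingDist
  have hm : MeasurableSet (N.servingDist ⁻¹' Ioi c) := N.measurable_servingDist measurableSet_Ioi
  have hc : Continuous fun t : ℝ => Complex.exp (-s * ((p.T * t : ℝ) : ℂ)) := by fun_prop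
  refine tendsto_nhds_unique (f := fun n : ℕ => ∫ ω in N.servingDist ⁻¹' Ioi c,
    Complex.exp (-s * ((p.T * N.tail (gridCeil c (1 / ((n : ℝ) + 1)) (N.servingDist ω)) ω : ℝ) : ℂ))
      ∂μ) (l := Filter.atTop) ?_ ?_
  · refine tendsto_integral_of_dominated_convergence (fun _ => 1)
      (fun n => (N.integrable_tail hs (htm n)).1.restrict) (integrable_const _)
      (fun n => Filter.Eventually.of_forall fun ω =>
        p.norm_cexp_neg_mul_T_le_one hs (N.tail_nonneg _ _)) ?_
    filter_upwards [ae_restrict_mem hm, ae_restrict_of_ae N.ae_summable_posPower] with ω h1 h2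
    exact (hc.tendsto _).comp (N.tendsto_tail h2 (tendsto_gridCeil h1)
      fun n => le_gridCeil (hpos n) _)
  · simp_rw [fun n : ℕ => N.setIntegral_gridCeil hs c (hpos n)]
    refine tendsto_integral_of_dominated_convergence (fun _ => 1)
      (fun n => (integrable_tailLaplace hs (htm n)).1.restrict) (integrable_const _)
      (fun n => Filter.Eventually.of_forall fun ω => norm_tailLaplace_le_one hs _) ?_
    filter_upwards [ae_restrict_mem hm] with ω h1
    exact tendsto_tailLaplace hs (tendsto_gridCeil h1) fun n => le_gridCeil (hpos n) _

/-! ### From half-lines to the conditional expectation. -/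

/-- Half-lines form a π-system generating the Borel sets. Equality of the total integrals is what
closes the class under complements. -/
theorem setIntegral_preimage_eq_of_Ioi {X : Ω → ℝ} (hX : Measurable X) {f g : Ω → ℂ}
    (hf : Integrable f μ) (hg : Integrable g μ) (huniv : ∫ ω, f ω ∂μ = ∫ ω, g ω ∂μ)
    (h : ∀ c, ∫ ω in X ⁻¹' Ioi c, f ω ∂μ = ∫ ω in X ⁻¹' Ioi c, g ω ∂μ) {B : Set ℝ}
    (hB : MeasurableSet B) : ∫ ω in X ⁻¹' B, f ω ∂μ = ∫ ω in X ⁻¹' B, g ω ∂μ := by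
  induction B, hB using MeasurableSpace.induction_on_inter (borel_eq_generateFrom_Ioi ℝ)
    isPiSystem_Ioi with
  | empty => simp
  | basic B hB => obtain ⟨c, rfl⟩ := hB; exact h c
  | compl B hB ih =>
    rw [preimage_compl, setIntegral_compl (hX hB) hf, setIntegral_compl (hX hB) hg, ih, huniv]
  | iUnion B hd hB ih =>
    have hd' : Pairwise (Function.onFun Disjoint fun i => X ⁻¹' B i) := fun i j hij =>
      (hd hij).preimage X
    rw [preimage_iUnion, integral_iUnion (fun i => hX (hB i)) hd' hf.integrableOn,
      integral_iUnion (fun i => hX (hB i)) hd' hg.integrableOn]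
    simp_rw [ih]

theorem servingDist_nonneg (ω : Ω) : 0 ≤ N.servingDist ω := norm_nonneg _

theorem tailLaplace_eq {s : ℂ} (hs : 0 ≤ s.re) {r : ℝ} (hr : 0 ≤ r) :
    tailLaplace p s r = Complex.exp (-2 * Real.pi * p.densBS *
      ∫ x in Ioi r, (x : ℂ) * (1 - p.cellLaplace !₂[x, 0] s)) := by
  rw [tailLaplace, Measure.restrict_smul, integral_smul_measure, p.setIntegral_norm_gt hs hr,
    ENNReal.toReal_ofReal p.densBS_pos.le, Complex.real_smul]
  congr 1; ring

theorem condExp_interference [IsProbabilityMeasure μ] {s : ℂ} (hs : 0 ≤ s.re) :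
    μ[fun ω => Complex.exp (-s * ((p.T * N.interference ω : ℝ) : ℂ)) |
        MeasurableSpace.comap N.servingDist inferInstance] =ᵐ[μ]
      fun ω => tailLaplace p s (N.servingDist ω) := by
  have hr := N.measurable_servingDist
  have hf := N.integrable_tail hs hr
  have hg := integrable_tailLaplace (p := p) (μ := μ) hs hr
  have huniv : ∫ ω, Complex.exp (-s * ((p.T * N.tail (N.servingDist ω) ω : ℝ) : ℂ)) ∂μ =
      ∫ ω, tailLaplace p s (N.servingDist ω) ∂μ := by
    -- The distance is nonnegative, so the negative threshold `-1` captures the whole space and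
    -- yields the total integrals.
    have h1 : N.servingDist ⁻¹' Ioi (-1) = univ :=
      eq_univ_of_forall fun ω => lt_of_lt_of_le (by norm_num) (N.servingDist_nonneg ω)
    have := N.setIntegral_tail_Ioi hs (-1)
    rwa [h1, setIntegral_univ, setIntegral_univ] at this
  have hcongr : (fun ω => Complex.exp (-s * ((p.T * N.interference ω : ℝ) : ℂ))) =ᵐ[μ]
      fun ω => Complex.exp (-s * ((p.T * N.tail (N.servingDist ω) ω : ℝ) : ℂ)) := by
    filter_upwards [N.ae_interference_eq] with ω hω
    rw [hω]
  refine (condExp_congr_ae hcongr).trans (Filter.EventuallyEq.symm ?_)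
  refine ae_eq_condExp_of_forall_setIntegral_eq hr.comap_le hf (fun _ _ _ => hg.integrableOn) ?_ ?_
  · rintro _ ⟨B, hB, rfl⟩ _
    exact (setIntegral_preimage_eq_of_Ioi hr hf hg huniv (N.setIntegral_tail_Ioi hs) hB).symm
  · exact ((measurable_tailLaplace s).comp
      (comap_measurable N.servingDist)).aestronglyMeasurable

end RISNetwork

theorem mainTheorem3 {Ω : Type*} [MeasurableSpace Ω] {μ : Measure Ω} [IsProbabilityMeasure μ]
    (p : NetworkParams) (N : RISNetwork p μ) :
    -- the aggregate interference is almost surely a convergent series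
    (∀ᵐ ω ∂μ, Summable fun i => N.interferer i ω) ∧
    ∀ s : ℂ, 0 ≤ s.re →
      -- the integral in the exponent converges absolutely
      (∀ r : ℝ, 0 ≤ r →
        IntegrableOn (fun x : ℝ => (x : ℂ) * (1 - p.cellLaplace !₂[x, 0] s)) (Ioi r)) ∧
      -- Laplace transform of the scaled interference given the distance to the serving BS
      μ[fun ω => Complex.exp (-s * ((p.T * N.interference ω : ℝ) : ℂ)) |
          MeasurableSpace.comap N.servingDist inferInstance] =ᵐ[μ]
        (fun ω => Complex.exp (-2 * Real.pi * p.densBS *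
          ∫ x in Ioi (N.servingDist ω), (x : ℂ) * (1 - p.cellLaplace !₂[x, 0] s))) ∧
      -- Laplace transform of the scaled interference from one cell
      (∀ a : Plane, p.cellLaplace a s =
        1 / (1 + s * p.P₀ * p.T * p.pathLoss ‖a‖) *
        Complex.exp (-((p.beam / (2 * Real.pi) : ℝ) : ℂ) * p.densRIS *
          ∫ ψ in (0 : ℝ)..(2 * Real.pi), ∫ y in p.Rin..p.Rout,
            (y : ℂ) * (1 - p.beamLaplace (s * p.P₀ * p.T * p.reflLossPolar ‖a‖ y ψ))) *
        Complex.exp (-((1 - p.beam / (2 * Real.pi) : ℝ) : ℂ) * p.densRIS *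
          ∫ ψ in (0 : ℝ)..(2 * Real.pi), ∫ y in p.Rin..p.Rout,
            (y : ℂ) * (1 - 1 / (1 + s * ((p.M : ℂ) - p.Mo) * p.P₀ * p.T *
              p.reflLossPolar ‖a‖ y ψ)))) ∧
      -- Laplace transform of the beamformed fading power
      p.beamLaplace s =
        Complex.exp (-((p.muRe : ℂ) ^ 2 * s / (1 + 2 * s * p.varRe))) /
          ((1 + 2 * s * p.varRe) * (1 + 2 * s * p.varIm)) ^ (1 / 2 : ℂ) := by
  refine ⟨N.ae_summable_interferer, fun s hs => ⟨fun r hr => p.integrableOn_radial hs hr, ?_,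
    fun a => p.cellLaplace_eq a hs, p.beamLaplace_eq hs⟩⟩
  filter_upwards [N.condExp_interference hs] with ω hω
  rw [hω, RISNetwork.tailLaplace_eq hs (N.servingDist_nonneg ω)]
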